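/- Let $k$ be a number field, let $\mathcal{C}$ be a curve over $k$ (that is, a smooth projective geometrically irreducible curve), and let $t\in k(\mathcal{C})$ be a non-constant rational function of degree $d=[k(\mathcal{C}):k(t)]$. For an extension $L/K$ of number fields put $$\mathcal{D}(L/K)=\bigl|\mathcal{N}_{K/\mathbb{Q}}\Delta(L/K)\bigr|^{1/[K:\mathbb{Q}]},$$ where $\Delta(L/K)$ is the (ideal) discriminant of $L$ over $K$, and let $$\mathrm{H}(\alpha)=\prod_{v\in M_K}\max\{1,|\alpha|_v\}^{[K_v:\mathbb{Q}_v]/[K:\mathbb{Q}]}\qquad(\alpha\in K)$$ be the absolute multiplicative height, where the absolute values in $M_K$ extend the standard absolute values of $\mathbb{Q}$. Then there exists a real number $c>0$, depending only on $\mathcal{C}$ and $t$, with the following property. Let $K$ be any number field containing $k$, and let $m$ be a positive integer such that there exists a non-constant rational function $x\in K(\mathcal{C})$ of degree $m$ with $K(\mathcal{C})=K(t,x)$. Then every point $P\in\mathcal{C}(\bar K)$ such that $$t(P)\in K,\qquad [K(P):K]=d$$ satisfies $$\mathcal{D}(K(P)/K)\le c\,\mathrm{H}(t(P))^{2m(d-1)}.$$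 -/

import Mathlib

open AlgebraicGeometry CategoryTheory CategoryTheory.Limits

universe u

/-- A curve over a field `k`: a smooth projective geometrically irreducible scheme of dimension one
over `k`.  (For a smooth one-dimensional scheme of finite type over a field, `projective` is the
same as `proper`; a smooth scheme over a field is geometrically reduced, so `geometrically
irreducible` is the same as `geometrically integral`.) -/
structure Curve (k : Type u) [Field k] where
  /-- the underlying scheme -/
  X : Scheme.{u}
  /-- the structure morphism -/
  str : X ⟶ Spec (.of k)
  proper : IsProper str
  smooth : SmoothOfRelativeDimension 1 str
  geomIntegral : GeometricallyIntegral str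

namespace Curve

attribute [instance] Curve.proper Curve.smooth Curve.geomIntegral

section Basic

variable {k : Type u} [Field k] (C : Curve k)

instance : Smooth C.str := SmoothOfRelativeDimension.smooth 1 C.str

instance : IsIntegral C.X := GeometricallyIntegral.isIntegral_of_subsingleton C.str

/-- The field `k(C)` of rational functions on `C`. -/
def FunctionField : Type u := C.X.functionField

noncomputable instance : Field C.FunctionField :=
  inferInstanceAs (Field C.X.functionField)

/-- The inclusion of the constants `k` into `k(C)`, given by the structure morphism. -/
noncomputable instance : Algebra k C.FunctionField :=
  RingHom.toAlgebra (S := C.FunctionField)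
    (Spec.preimage (C.X.fromSpecStalk (genericPoint C.X) ≫ C.str)).hom

/-- A rational function is non-constant if it does not belong to `k`. -/
def IsNonconstant (t : C.FunctionField) : Prop :=
  t ∉ Set.range (algebraMap k C.FunctionField)

/-- The degree `[k(C) : k(t)]` of a non-constant rational function `t`, that is, the degree of the
finite morphism from `C` to the projective line defined by `t`. -/
noncomputable def functionDegree (t : C.FunctionField) : ℕ :=
  Module.finrank (IntermediateField.adjoin k {t}) C.FunctionField

/-- The set `C(L)` of `L`-points of `C`, for a field `L` containing `k`. -/
structure Point (L : Type u) [Field L] [Algebra k L] where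
  /-- the morphism from the spectrum of `L` -/
  hom : Spec (.of L) ⟶ C.X
  hom_str : hom ≫ C.str = Spec.map (CommRingCat.ofHom (algebraMap k L))

variable {C} {L : Type u} [Field L] [Algebra k L]

/-- The point of the scheme which underlies an `L`-point. -/
noncomputable def Point.pt (P : C.Point L) : C.X := P.hom (IsLocalRing.closedPoint L)

/-- Evaluation at `P` of the functions regular at `P`: the homomorphism from the local ring of `C`
at `P` to `L`.  It factors through the residue field. -/
noncomputable def Point.eval (P : C.Point L) : C.X.presheaf.stalk P.pt →+* L :=
  (Scheme.stalkClosedPointTo P.hom).hom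

/-- `t(P) = a`: the rational function `t` is regular at `P` and takes the value `a` there. -/
def HasValue (t : C.FunctionField) (P : C.Point L) (a : L) : Prop :=
  ∃ g : C.X.presheaf.stalk P.pt,
    algebraMap (C.X.presheaf.stalk P.pt) C.X.functionField g = t ∧ P.eval g = a

/-- The field `k(P)`, generated over `k` by the values at `P` of the functions regular at `P`;
that is, the image in `L` of the residue field of `C` at `P`. -/
noncomputable def Point.field (P : C.Point L) : IntermediateField k L :=
  IntermediateField.adjoin k (Set.range P.eval)

end Basic

section BaseChange

variable {k : Type u} [Field k] (C : Curve k) (K : Type u) [Field K] [Algebra k K]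

/-- The curve `C`, considered as a curve over the larger field `K`. -/
noncomputable def baseChange : Curve K where
  X := pullback C.str (Spec.map (CommRingCat.ofHom (algebraMap k K)))
  str := pullback.snd C.str (Spec.map (CommRingCat.ofHom (algebraMap k K)))
  proper := inferInstance
  smooth :=
    (smoothOfRelativeDimension_isStableUnderBaseChange 1).of_isPullback
      (IsPullback.of_hasPullback _ _) C.smooth
  geomIntegral := inferInstance

/-- The projection from the base change of `C` to `C`. -/
noncomputable def baseChangeProj : (C.baseChange K).X ⟶ C.X :=
  pullback.fst C.str (Spec.map (CommRingCat.ofHom (algebraMap k K)))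

instance : Surjective (Spec.map (CommRingCat.ofHom (algebraMap k K))) :=
  ⟨fun y => ⟨IsLocalRing.closedPoint K, Subsingleton.elim _ y⟩⟩

instance : Surjective (C.baseChangeProj K) :=
  inferInstanceAs (Surjective (pullback.fst _ _))

lemma baseChangeProj_genericPoint :
    C.baseChangeProj K (genericPoint (C.baseChange K).X) = genericPoint C.X := by
  apply ((genericPoint_spec C.X).eq _).symm
  have h := (genericPoint_spec (C.baseChange K).X).image (C.baseChangeProj K).continuous
  rwa [Set.image_univ, (C.baseChangeProj K).surjective.range_eq, closure_univ] at h

/-- The inclusion of `k(C)` into `K(C)`: pull-back of rational functions under the projection. -/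
noncomputable def functionFieldMap : C.FunctionField →+* (C.baseChange K).FunctionField :=
  (C.X.presheaf.stalkSpecializes (specializes_of_eq (C.baseChangeProj_genericPoint K)) ≫
    (C.baseChangeProj K).stalkMap (genericPoint (C.baseChange K).X)).hom

end BaseChange

end Curve

/-- The discriminant `Δ(L/K)` of an extension of number fields: the ideal of the ring of integers
of `K` generated by the discriminants of all `K`-bases of `L` which consist of algebraic integers. -/
def relativeDiscriminant (K L : Type*) [Field K] [Field L] [Algebra K L] :
    Ideal (NumberField.RingOfIntegers K) :=
  Ideal.span {δ | ∃ b : Module.Basis (Fin (Module.finrank K L)) K L,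
    (∀ i, IsIntegral ℤ (b i)) ∧
      algebraMap (NumberField.RingOfIntegers K) K δ = Algebra.discr K b}

/-- The normalized discriminant `𝒟(L/K) = |N_{K/ℚ} Δ(L/K)| ^ (1 / [K : ℚ])`. -/
noncomputable def normalizedDiscriminant (K L : Type*) [Field K] [NumberField K] [Field L]
    [Algebra K L] : ℝ :=
  (Ideal.absNorm (relativeDiscriminant K L) : ℝ) ^ ((Module.finrank ℚ K : ℝ)⁻¹)

/-- The absolute multiplicative height of an element `α` of a number field `K`:
`H(α) = ∏ᵥ max {1, |α|ᵥ} ^ ([Kᵥ : ℚᵥ] / [K : ℚ])`, where `v` runs through all places of `K` and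
`|·|ᵥ` extends a standard absolute value of `ℚ`.  (`Height.mulHeight₁` is the same product with the
exponents `[Kᵥ : ℚᵥ]`.) -/
noncomputable def absoluteHeight {K : Type*} [Field K] [NumberField K] (α : K) : ℝ :=
  Height.mulHeight₁ α ^ ((Module.finrank ℚ K : ℝ)⁻¹)

/-! Suppose w in k(C) is integral over k[t] and its poles are at most a times those of t. Its
minimal polynomial over k(t) then has coefficients in k[T], and the coefficient of Y^(n-j) has
degree at most ja (`PoleBounded.exists_isWeighted`). Specializing t to α in K turns the value of w
into a root of a polynomial with controlled coefficients. If such values β_i, with weights a_i, form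
a basis of L over K, then discr(β_i) has archimedean size O(max(1, |α|)^(2Σa_i)). Multiplying β_i by
D_i b^(a_i), for b a denominator of α, makes it integral. Together the two estimates give 𝒟(L/K) ≤ c
H(α)^(2Σa_i) (`IsWeighted.exists_normalizedDiscriminant_le`).

It remains to find d such functions over k with Σa_i = m(d-1). If K(C) = K(t, x) with x of degree m,
the irreducible relation F(t, x) = 0 has degree at most m in t. The truncations of F, seen as a
polynomial in x, have poles bounded by those of t^m and span K(C) over K(t)
(`span_poleBounded_eq_top`). The constant 1 can replace one of them at weight 0, hence d-1 instead
of d.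

The constant must not depend on K or m, so the spanning property is descended to k: coordinates with
respect to a k-basis of K are traces, and preserve both integrality conditions
(`span_poleBounded_eq_top_of_basis`). The least m with this property depends only on C and t, and it
serves every K.

The values at P of the functions integral over k[t] span K(P) over K, because local rings of a
smooth curve are normal (`exists_specialization`). The chosen d functions still give a basis at P
unless t(P) is a root of one fixed polynomial. Such α have bounded height, and finitely many other
bases deal with them. -/

/-! ### Roots of weighted polynomials: archimedean size and denominators. -/

open Polynomial in
/-- A monic polynomial in `Y` over `k[T]` which is dominated by the weight `a`: the coefficient of
`Y ^ (n - j)` has degree at most `j * a` in `T`, where `n` is the degree in `Y`. -/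
structure IsWeighted {k : Type*} [Field k] (a : ℕ) (G : k[X][X]) : Prop where
  monic : G.Monic
  natDegree_coeff_le : ∀ j, (G.coeff j).natDegree ≤ (G.natDegree - j) * a

namespace IsWeighted

open Polynomial

variable {k : Type*} [Field k] {a : ℕ} {G : k[X][X]}

/-- Cauchy's root bound: if ‖y‖ exceeds M^a with M = max(1, ‖z‖), all but one factor M^a in each
lower term can be replaced by ‖y‖, which leaves ‖y‖ ≤ n s M^a. Summing over all embeddings of k in
`s` makes `B` uniform, so it applies to the embeddings of every larger field. -/
lemma exists_norm_root_le [NumberField k] (hG : IsWeighted a G) :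
    ∃ B : ℝ, 1 ≤ B ∧ ∀ (σ : k →+* ℂ) (z y : ℂ), (G.map (eval₂RingHom σ z)).eval y = 0 →
      ‖y‖ ≤ B * max 1 ‖z‖ ^ a := by
  set n := G.natDegree with hn
  set s : ℝ := ∑ σ : k →+* ℂ, ∑ j ∈ Finset.range n,
    ∑ l ∈ Finset.range ((G.coeff j).natDegree + 1), ‖σ ((G.coeff j).coeff l)‖ with hs
  have hs0 : 0 ≤ s := by positivity
  refine ⟨1 + n * s, by linarith [mul_nonneg n.cast_nonneg hs0], fun σ z y hy ↦ ?_⟩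
  set M := max 1 ‖z‖ with hM
  have hM1 : 1 ≤ M := le_max_left _ _
  have hc (j : ℕ) (hj : j < n) : ‖(G.coeff j).eval₂ σ z‖ ≤ s * (M ^ a) ^ (n - j) := by
    rw [eval₂_eq_sum_range]
    calc _ ≤ ∑ l ∈ Finset.range ((G.coeff j).natDegree + 1),
          ‖σ ((G.coeff j).coeff l)‖ * (M ^ a) ^ (n - j) := by
          refine norm_sum_le_of_le _ fun l hl ↦ ?_
          rw [norm_mul, norm_pow, ← pow_mul]
          gcongr
          calc ‖z‖ ^ l ≤ M ^ l := by gcongr; exact le_max_right _ _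
            _ ≤ M ^ (a * (n - j)) := by
              refine pow_le_pow_right₀ hM1 ?_
              · have := hG.natDegree_coeff_le j
                rw [Finset.mem_range] at hl
                rw [← hn] at this; rw [mul_comm]; omega
      _ = (∑ l ∈ Finset.range ((G.coeff j).natDegree + 1),
          ‖σ ((G.coeff j).coeff l)‖) * (M ^ a) ^ (n - j) := by rw [Finset.sum_mul]
      _ ≤ _ := by
        gcongr
        rw [hs]
        refine le_trans ?_ (Finset.single_le_sum (f := fun σ : k →+* ℂ ↦ ∑ j ∈ Finset.range n,
          ∑ l ∈ Finset.range ((G.coeff j).natDegree + 1), ‖σ ((G.coeff j).coeff l)‖)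
          (fun _ _ ↦ by positivity) (Finset.mem_univ σ))
        exact Finset.single_le_sum (f := fun j ↦
          ∑ l ∈ Finset.range ((G.coeff j).natDegree + 1), ‖σ ((G.coeff j).coeff l)‖)
          (fun _ _ ↦ by positivity) (Finset.mem_range.mpr hj)
  have hmon : (G.map (eval₂RingHom σ z)).Monic := hG.monic.map _
  have hdeg : (G.map (eval₂RingHom σ z)).natDegree = n := hG.monic.natDegree_map _
  have hsum : y ^ n = -∑ j ∈ Finset.range n, (G.coeff j).eval₂ σ z * y ^ j := by
    rw [eval_eq_sum_range, hdeg, Finset.sum_range_succ] at hy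
    have h1 : (G.map (eval₂RingHom σ z)).coeff n = 1 := by
      rw [← hdeg]; exact hmon
    rw [h1, one_mul] at hy
    simp only [coeff_map, coe_eval₂RingHom] at hy
    linear_combination hy
  by_contra! hlt
  have hQ : 1 ≤ M ^ a := one_le_pow₀ hM1
  have hRQ : M ^ a < ‖y‖ := by
    refine lt_of_le_of_lt ?_ hlt
    nlinarith [mul_nonneg (n.cast_nonneg : (0 : ℝ) ≤ n) hs0]
  have hR : 0 < ‖y‖ := by linarith
  have hn0 : n ≠ 0 := by
    intro h0
    rw [h0] at hsum
    simp at hsum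
  have hle : ‖y‖ ^ n ≤ n * s * M ^ a * ‖y‖ ^ (n - 1) := by
    calc ‖y‖ ^ n = ‖∑ j ∈ Finset.range n, (G.coeff j).eval₂ σ z * y ^ j‖ := by
          rw [← norm_pow, hsum, norm_neg]
      _ ≤ ∑ j ∈ Finset.range n, s * M ^ a * ‖y‖ ^ (n - 1) := by
          refine norm_sum_le_of_le _ fun j hj ↦ ?_
          rw [Finset.mem_range] at hj
          rw [norm_mul, norm_pow]
          calc _ ≤ s * (M ^ a) ^ (n - j) * ‖y‖ ^ j := by gcongr; exact hc j hj
            _ = s * M ^ a * ((M ^ a) ^ (n - 1 - j) * ‖y‖ ^ j) := by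
              rw [show n - j = (n - 1 - j) + 1 by omega, pow_succ]; ring
            _ ≤ s * M ^ a * (‖y‖ ^ (n - 1 - j) * ‖y‖ ^ j) := by gcongr
            _ = _ := by rw [← pow_add, show n - 1 - j + j = n - 1 by omega]
      _ = _ := by simp; ring
  have h2 : ‖y‖ ≤ n * s * M ^ a := by
    have : ‖y‖ ^ n = ‖y‖ * ‖y‖ ^ (n - 1) := by
      rw [← pow_succ', Nat.sub_add_cancel (Nat.pos_of_ne_zero hn0)]
    rw [this] at hle
    exact le_of_mul_le_mul_right hle (by positivity)
  nlinarith

lemma exists_natCast_mul_isIntegral [NumberField k] (G : k[X][X]) :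
    ∃ D : ℕ, D ≠ 0 ∧ ∀ j l, IsIntegral ℤ ((D : k) * (G.coeff j).coeff l) := by
  classical
  obtain ⟨y, hy, h⟩ := exists_integral_multiples ℤ ℚ (L := k)
    (G.support.biUnion fun j ↦ (G.coeff j).support.image (G.coeff j).coeff)
  refine ⟨y.natAbs, by simpa using hy, fun j l ↦ ?_⟩
  by_cases h0 : (G.coeff j).coeff l = 0
  · simpa [h0] using isIntegral_zero
  have hmem : (G.coeff j).coeff l ∈
      G.support.biUnion fun j ↦ (G.coeff j).support.image (G.coeff j).coeff := by
    simp only [Finset.mem_biUnion, mem_support_iff, Finset.mem_image]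
    exact ⟨j, fun hj ↦ h0 (by simp [hj]), l, h0, rfl⟩
  have := h _ hmem
  rcases Int.natAbs_eq y with h' | h' <;> rw [h'] at this
  · simpa using this
  · simpa using this.neg

lemma isIntegral_mul_eval₂ {K : Type*} [Field K] (f : k →+* K) {c : k[X]} {D : k}
    (hD : ∀ l, IsIntegral ℤ (D * c.coeff l)) {b α : K} (hb : IsIntegral ℤ b)
    (hbα : IsIntegral ℤ (b * α)) {e : ℕ} (he : c.natDegree ≤ e) :
    IsIntegral ℤ (f D * b ^ e * c.eval₂ f α) := by
  rw [eval₂_eq_sum_range, Finset.mul_sum]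
  refine IsIntegral.sum _ fun l hl ↦ ?_
  rw [Finset.mem_range] at hl
  have : f D * b ^ e * (f (c.coeff l) * α ^ l) =
      f (D * c.coeff l) * b ^ (e - l) * (b * α) ^ l := by
    rw [show b ^ e = b ^ (e - l) * b ^ l by rw [← pow_add]; congr 1; omega]
    rw [map_mul]; ring
  rw [this]
  exact ((map_isIntegral_int f (hD l)).mul (hb.pow _)).mul (hbα.pow _)

/-- Scaling the root by D b^a multiplies the coefficient of Y^j by (D b^a)^(n-j). The weight
condition says exactly that b^(a(n-j)) clears the powers of α there; one factor D clears the
coefficients in k. -/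
lemma isIntegral_mul_root (hG : IsWeighted a G) {D : ℕ}
    (hD : ∀ j l, IsIntegral ℤ ((D : k) * (G.coeff j).coeff l))
    {K L : Type*} [Field K] [Field L] [Algebra k K] [Algebra K L] {b α : K} (hb : IsIntegral ℤ b)
    (hbα : IsIntegral ℤ (b * α)) {β : L}
    (hβ : aeval β (G.map (eval₂RingHom (algebraMap k K) α)) = 0) :
    IsIntegral ℤ (algebraMap K L (D * b ^ a) * β) := by
  set p := G.map (eval₂RingHom (algebraMap k K) α) with hp
  have hpm : p.Monic := hG.monic.map _
  have hpd : p.natDegree = G.natDegree := hG.monic.natDegree_map _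
  have hroot := scaleRoots_aeval_eq_zero (r := (D : K) * b ^ a) hβ
  have hcoeff (j : ℕ) : IsIntegral ℤ ((p.scaleRoots (D * b ^ a)).coeff j) := by
    rw [coeff_scaleRoots, hpd]
    rcases lt_or_ge j G.natDegree with hj | hj
    · obtain ⟨e, he⟩ : ∃ e, G.natDegree - j = e + 1 := ⟨G.natDegree - j - 1, by omega⟩
      have := isIntegral_mul_eval₂ (algebraMap k K) (hD j) hb hbα (hG.natDegree_coeff_le j)
      rw [he] at this ⊢
      have h2 : p.coeff j * (D * b ^ a) ^ (e + 1) = (D : K) ^ e *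
          (algebraMap k K D * b ^ ((e + 1) * a) * eval₂ (algebraMap k K) α (G.coeff j)) := by
        rw [hp, coeff_map, coe_eval₂RingHom, mul_pow, ← pow_mul, mul_comm a, map_natCast]
        ring
      rw [h2]
      exact ((_root_.isIntegral_natCast D).pow _).mul this
    · rw [Nat.sub_eq_zero_of_le hj, pow_zero, mul_one]
      rcases hj.eq_or_lt with hj | hj
      · rw [← hj, ← hpd, show p.coeff p.natDegree = 1 from hpm]; exact isIntegral_one
      · rw [coeff_eq_zero_of_natDegree_lt (hpd ▸ hj)]; exact isIntegral_zero
  have hm : (p.scaleRoots (D * b ^ a)).Monic := (monic_scaleRoots_iff _).mpr hpm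
  refine IsIntegral.of_aeval_monic_of_isIntegral_coeff (p := (p.scaleRoots
    (D * b ^ a)).map (algebraMap K L)) (hm.map _) ?_ ?_ fun j ↦ ?_
  · intro h0
    rw [natDegree_map, natDegree_scaleRoots] at h0
    have h1 : p = 1 := hpm.natDegree_eq_zero.mp h0
    rw [h1] at hβ
    simp at hβ
  · rw [eval_map_algebraMap, hroot]; exact isIntegral_zero
  · rw [coeff_map]; exact (hcoeff j).map (algebraMap K L).toIntAlgHom

end IsWeighted

/-! ### Denominator ideals and the height. -/

/-- In a Dedekind domain the `N`-th powers of the nonzero elements of an ideal generate its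
`N`-th power. -/
lemma Ideal.pow_le_span_pow {R : Type*} [CommRing R] [IsDedekindDomain R] {I : Ideal R}
    (hI : I ≠ ⊥) (N : ℕ) : I ^ N ≤ Ideal.span {x | ∃ b ∈ I, b ≠ 0 ∧ x = b ^ N} := by
  set c := Ideal.span {x | ∃ b ∈ I, b ≠ 0 ∧ x = b ^ N} with hc
  have hle : c ≤ I ^ N := by
    rw [hc, Ideal.span_le]
    rintro _ ⟨b, hb, -, rfl⟩
    exact Ideal.pow_mem_pow hb N
  obtain ⟨e, he⟩ := Ideal.dvd_iff_le.mpr hle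
  suffices e = ⊤ by rw [he, this, Ideal.mul_top]
  by_contra hne
  obtain ⟨P, hP, heP⟩ := Ideal.exists_le_maximal e hne
  -- Choosing b in I outside IP gives (b) = IB with B not contained in P, whereas b^N in I^N e
  -- forces B^N ≤ e ≤ P.
  have hlt : ¬ I ≤ I * P := by
    intro h
    have h1 : I * P = I * ⊤ := by
      rw [Ideal.mul_top]; exact le_antisymm Ideal.mul_le_left h
    exact hP.ne_top (mul_left_cancel₀ hI h1)
  obtain ⟨b, hb, hbP⟩ := Set.not_subset.mp hlt
  have hb0 : b ≠ 0 := by rintro rfl; exact hbP (zero_mem _)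
  obtain ⟨B, hB⟩ := Ideal.dvd_iff_le.mpr ((Ideal.span_singleton_le_iff_mem I).mpr hb)
  have h2 : I ^ N * B ^ N ≤ I ^ N * e := by
    rw [← mul_pow, ← hB, ← he, Ideal.span_singleton_pow, Ideal.span_singleton_le_iff_mem]
    exact Ideal.subset_span ⟨b, hb, hb0, rfl⟩
  have h3 : B ^ N ≤ e := by
    rw [← Ideal.dvd_iff_le] at h2 ⊢
    exact (mul_dvd_mul_iff_left (pow_ne_zero N hI)).mp h2
  have h4 : B ≤ P := hP.isPrime.le_of_pow_le (h3.trans heP)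
  apply hbP
  have : b ∈ I * B := hB ▸ Ideal.mem_span_singleton_self b
  exact Ideal.mul_mono_right h4 this

open NumberField Height in
/-- An ideal which contains `b ^ N * θ` for all denominators `b` of `α` has bounded norm. -/
lemma NumberField.absNorm_mul_prod_le {K : Type*} [Field K] [NumberField K] {Δ : Ideal (𝓞 K)}
    {θ α : K} (hθ : θ ≠ 0) (N : ℕ)
    (h : ∀ b : 𝓞 K, b ≠ 0 → IsIntegral ℤ (b * α) → ∃ δ ∈ Δ, (δ : K) = b ^ N * θ) :
    (Ideal.absNorm Δ : ℝ) * (∏ w : InfinitePlace K, max (w α) 1 ^ w.mult) ^ N ≤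
      mulHeight₁ α ^ N * |(Algebra.norm ℚ θ : ℝ)| := by
  obtain ⟨p, q, hq, rfl⟩ := IsFractionRing.div_surjective (A := 𝓞 K) α
  have hq0 : q ≠ 0 := nonZeroDivisors.ne_zero hq
  have hqK : (q : K) ≠ 0 := RingOfIntegers.coe_ne_zero_iff.mpr hq0
  set J := Ideal.span (Set.range ![p, q]) with hJ
  have hqJ : q ∈ J := Ideal.subset_span ⟨1, rfl⟩
  have hpJ : p ∈ J := Ideal.subset_span ⟨0, rfl⟩
  -- The ideal d = (q)/(p, q) is the denominator ideal of α = p/q.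
  obtain ⟨d, hd⟩ := Ideal.dvd_iff_le.mpr ((Ideal.span_singleton_le_iff_mem J).mpr hqJ)
  have hd0 : d ≠ ⊥ := by
    rintro rfl
    rw [Ideal.mul_bot, Ideal.span_singleton_eq_bot] at hd
    exact hq0 hd
  have hint (b : 𝓞 K) (hb : b ∈ d) : IsIntegral ℤ ((b : K) * (p / q)) := by
    have : p * b ∈ Ideal.span {q} := hd ▸ Ideal.mul_mem_mul hpJ hb
    obtain ⟨r, hr⟩ := Ideal.mem_span_singleton.mp this
    have hr' : (p : K) * b = q * r := by exact_mod_cast congrArg (algebraMap (𝓞 K) K) hr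
    have : (b : K) * (p / q) = r := by field_simp; linear_combination hr'
    rw [this]; exact r.isIntegral_coe
  have hqint : IsIntegral ℤ ((q : K) * (p / q)) := by
    rw [mul_div_cancel₀ _ hqK]; exact p.isIntegral_coe
  obtain ⟨θq, hθq, hθqe⟩ := h q hq0 hqint
  -- Here θq = q^N θ, so for each generator b^N of d^N one has b^N θq = q^N δ with δ in Δ. Taking
  -- norms bounds N(Δ) by N(d)^N |N(θ)|.
  have hle : d ^ N * Ideal.span {θq} ≤ Ideal.span {q} ^ N * Δ := by
    refine (Ideal.mul_mono_left (Ideal.pow_le_span_pow hd0 N)).trans ?_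
    rw [Ideal.span_mul_span', Ideal.span_le]
    intro x hx
    obtain ⟨_, ⟨b, hb, hb0, rfl⟩, y, hy, rfl⟩ := Set.mem_mul.mp hx
    obtain rfl : y = θq := hy
    obtain ⟨δ, hδ, hδe⟩ := h b hb0 (hint b hb)
    have : b ^ N * y = q ^ N * δ := by
      apply RingOfIntegers.coe_injective
      simp only [map_mul, map_pow]
      linear_combination (b : K) ^ N * hθqe - (q : K) ^ N * hδe
    rw [this, Ideal.span_singleton_pow]
    exact Ideal.mul_mem_mul (Ideal.mem_span_singleton_self _) hδ
  have hdvd := Ideal.absNorm_dvd_absNorm_of_le hle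
  have hnq : (Ideal.absNorm (Ideal.span {q}) : ℝ) = |(Algebra.norm ℚ (q : K) : ℝ)| := by
    rw [Ideal.absNorm_span_singleton, ← Algebra.coe_norm_int]
    simp [Nat.cast_natAbs]
  have hnθ : (Ideal.absNorm (Ideal.span {θq}) : ℝ) =
      |(Algebra.norm ℚ (q : K) : ℝ)| ^ N * |(Algebra.norm ℚ θ : ℝ)| := by
    rw [Ideal.absNorm_span_singleton, ← abs_pow, ← abs_mul]
    have : Algebra.norm ℚ (θq : K) = Algebra.norm ℚ (q : K) ^ N * Algebra.norm ℚ θ := by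
      rw [hθqe, map_mul, map_pow]
    rw [Nat.cast_natAbs, Int.cast_abs]
    congr 1
    have h2 := Algebra.coe_norm_int θq
    rw [this] at h2
    exact_mod_cast congrArg (Rat.cast : ℚ → ℝ) h2
  have hθq0 : θq ≠ 0 := by
    have : (θq : K) ≠ 0 := hθqe ▸ mul_ne_zero (pow_ne_zero _ hqK) hθ
    exact RingOfIntegers.coe_ne_zero_iff.mp this
  have hne : Ideal.absNorm (d ^ N * Ideal.span {θq}) ≠ 0 := by
    rw [Ne, Ideal.absNorm_eq_zero_iff]
    exact mul_ne_zero (pow_ne_zero _ hd0) (by simpa using hθq0)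
  have hle2 := Nat.le_of_dvd (Nat.pos_of_ne_zero hne) hdvd
  rw [map_mul, map_mul, map_pow, map_pow] at hle2
  have hle3 : (Ideal.absNorm (Ideal.span {q}) : ℝ) ^ N * Ideal.absNorm Δ ≤
      (Ideal.absNorm d : ℝ) ^ N * Ideal.absNorm (Ideal.span {θq}) := by exact_mod_cast hle2
  have hqpos : 0 < |(Algebra.norm ℚ (q : K) : ℝ)| := by
    rw [abs_pos]; exact_mod_cast Algebra.norm_ne_zero_iff.mpr hqK
  rw [hnθ, hnq] at hle3
  have hle4 : (Ideal.absNorm Δ : ℝ) ≤ (Ideal.absNorm d : ℝ) ^ N * |(Algebra.norm ℚ θ : ℝ)| := by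
    refine le_of_mul_le_mul_left ?_ (pow_pos hqpos N)
    linarith
  have hJd : (Ideal.absNorm J : ℝ) * Ideal.absNorm d = |(Algebra.norm ℚ (q : K) : ℝ)| := by
    rw [← hnq, hd, map_mul, Nat.cast_mul]
  -- The finite places contribute exactly N(d) to the height.
  have hheight : mulHeight₁ ((p : K) / q) =
      (∏ w : InfinitePlace K, max (w ((p : K) / q)) 1 ^ w.mult) * Ideal.absNorm d := by
    have hne : (![p, q] : Fin 2 → 𝓞 K) ≠ 0 := fun h ↦ hq0 (congrFun h 1)
    have hF := absNorm_mul_finprod_finitePlace_eq_one hne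
    have hneK : (![(p : K), q] : Fin 2 → K) ≠ 0 := fun h ↦ hqK (congrFun h 1)
    have hv (i : Fin 2) : (![p, q] i : K) = ![(p : K), q] i := by fin_cases i <;> rfl
    simp only [hv] at hF
    rw [← hJ] at hF
    have hJ0 : (Ideal.absNorm J : ℝ) ≠ 0 := fun h0 ↦ by simp [h0] at hF
    rw [mulHeight₁_div_eq_mulHeight, mulHeight_eq hneK]
    have hA : ∏ w : InfinitePlace K, (⨆ i, w (![(p : K), q] i)) ^ w.mult =
        (∏ w : InfinitePlace K, max (w ((p : K) / q)) 1 ^ w.mult) *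
          |(Algebra.norm ℚ (q : K) : ℝ)| := by
      have := InfinitePlace.prod_eq_abs_norm (q : K)
      rw [Rat.cast_abs] at this
      rw [← this, ← Finset.prod_mul_distrib]
      refine Finset.prod_congr rfl fun w _ ↦ ?_
      have hwq : 0 < w (q : K) := InfinitePlace.pos_iff.mpr hqK
      rw [← mul_pow, max_mul_of_nonneg _ _ hwq.le, one_mul, ← map_mul, div_mul_cancel₀ _ hqK]
      congr 1
      rw [ciSup_eq_of_forall_le_of_forall_lt_exists_gt]
      · intro i; fin_cases i <;> simp
      · intro x hx
        rcases lt_max_iff.mp hx with hx | hx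
        · exact ⟨0, hx⟩
        · exact ⟨1, hx⟩
    rw [hA, mul_assoc, ← hJd]
    congr 1
    linear_combination (Ideal.absNorm d : ℝ) * hF
  rw [hheight, mul_pow]
  have hApos : 0 ≤ (∏ w : InfinitePlace K, max (w ((p : K) / q)) 1 ^ w.mult) ^ N := by positivity
  nlinarith [mul_le_mul_of_nonneg_right hle4 hApos]

/-! ### Bounding the discriminant by the height. -/

lemma Matrix.norm_det_le_of_norm_le {n : Type*} [Fintype n] [DecidableEq n] {A : Matrix n n ℂ}
    {R : n → ℝ} (h : ∀ i j, ‖A i j‖ ≤ R i) :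
    ‖A.det‖ ≤ (Fintype.card n).factorial * ∏ i, R i := by
  rw [← Matrix.det_transpose, Matrix.det_apply]
  refine (norm_sum_le_of_le (f := fun σ : Equiv.Perm n ↦ Equiv.Perm.sign σ • ∏ i, A.transpose (σ i) i)
    (n := fun _ ↦ ∏ i, R i) _ fun σ _ ↦ ?_).trans ?_
  · rw [Units.smul_def, zsmul_eq_mul, norm_mul, norm_prod]
    have : ‖((Equiv.Perm.sign σ : ℤ) : ℂ)‖ = 1 := by
      rcases Int.units_eq_one_or (Equiv.Perm.sign σ) with h | h <;> simp [h]
    rw [this, one_mul]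
    exact Finset.prod_le_prod (fun _ _ ↦ norm_nonneg _) fun i _ ↦ h _ _
  · simp [Fintype.card_perm]

lemma Algebra.discr_smul {A B ι : Type*} [CommRing A] [CommRing B] [Algebra A B] [Fintype ι]
    [DecidableEq ι] (b : ι → B) (s : ι → A) :
    Algebra.discr A (fun i ↦ algebraMap A B (s i) * b i) =
      (∏ i, s i) ^ 2 * Algebra.discr A b := by
  have := Algebra.discr_of_matrix_vecMul b (Matrix.diagonal s)
  rw [Matrix.det_diagonal] at this
  rw [← this]
  congr 1
  ext i
  rw [Matrix.diagonal_map (map_zero _), Matrix.vecMul_diagonal, mul_comm]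

lemma relativeDiscriminant_mem {K L : Type*} [Field K] [NumberField K] [Field L] [Algebra K L]
    {ι : Type*} [Fintype ι] [DecidableEq ι] (b : Module.Basis ι K L)
    (hb : ∀ i, IsIntegral ℤ (b i)) :
    ∃ δ ∈ relativeDiscriminant K L, (δ : K) = Algebra.discr K b := by
  have : Module.Finite K L := .of_basis b
  have hint : IsIntegral ℤ (Algebra.discr K b) := Algebra.discr_isIntegral K hb
  refine ⟨⟨_, hint⟩, Ideal.subset_span ?_, rfl⟩
  have e : ι ≃ Fin (Module.finrank K L) := Fintype.equivFinOfCardEq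
    (Module.finrank_eq_card_basis b).symm
  refine ⟨b.reindex e, fun i ↦ by simpa using hb _, ?_⟩
  rw [Module.Basis.coe_reindex, Algebra.discr_reindex]
  rfl

namespace IsWeighted

open Polynomial NumberField Height

/-- The discriminant of an extension which has a basis consisting of roots of specialized weighted
polynomials is bounded in terms of the height of the argument and of the weights. -/
theorem exists_normalizedDiscriminant_le {k : Type*} [Field k] [NumberField k]
    {ι : Type*} [Fintype ι] {a : ι → ℕ} {G : ι → k[X][X]} (hG : ∀ i, IsWeighted (a i) (G i)) :
    ∃ c : ℝ, 0 < c ∧ ∀ (K : Type*) [Field K] [NumberField K] [Algebra k K] (L : Type*) [Field L]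
      [Algebra K L] (β : Module.Basis ι K L) (α : K),
      (∀ i, aeval (β i) ((G i).map (eval₂RingHom (algebraMap k K) α)) = 0) →
      normalizedDiscriminant K L ≤ c * absoluteHeight α ^ (2 * ∑ i, a i) := by
  classical
  choose D hD0 hD using fun i ↦ exists_natCast_mul_isIntegral (G i)
  choose B hB1 hB using fun i ↦ (hG i).exists_norm_root_le
  set c : ℝ := (∏ i, (D i : ℝ)) ^ 2 * ((Fintype.card ι).factorial * ∏ i, B i) ^ 2 with hc
  have hcpos : 0 < c := by
    have h1 : 0 < ∏ i, (D i : ℝ) := Finset.prod_pos fun i _ ↦ by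
      exact_mod_cast Nat.pos_of_ne_zero (hD0 i)
    have h2 : 0 < ∏ i, B i := Finset.prod_pos fun i _ ↦ by linarith [hB1 i]
    positivity
  refine ⟨c, hcpos, fun K _ _ _ L _ _ β α hβ ↦ ?_⟩
  have : Module.Finite K L := .of_basis β
  have : CharZero L := charZero_of_injective_algebraMap (algebraMap K L).injective
  set N := 2 * ∑ i, a i with hN
  set θ : K := (∏ i, (D i : K)) ^ 2 * Algebra.discr K β with hθ
  have hDK : (∏ i, (D i : K)) ≠ 0 :=
    Finset.prod_ne_zero_iff.mpr fun i _ ↦ by exact_mod_cast hD0 i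
  have hθ0 : θ ≠ 0 := mul_ne_zero (pow_ne_zero _ hDK) (Algebra.discr_not_zero_of_basis K β)
  -- For a denominator b of α the elements D_i b^(a_i) β_i form an integral basis of L over K in the
  -- sense of `relativeDiscriminant`, of discriminant b^N θ.
  have key := absNorm_mul_prod_le (Δ := relativeDiscriminant K L) (α := α) hθ0 N
    fun b hb hbα ↦ by
      have hbK : (b : K) ≠ 0 := RingOfIntegers.coe_ne_zero_iff.mpr hb
      have hu (i : ι) : (D i : K) * (b : K) ^ a i ≠ 0 :=
        mul_ne_zero (by exact_mod_cast hD0 i) (pow_ne_zero _ hbK)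
      have huL (i : ι) : IsUnit (algebraMap K L (D i * (b : K) ^ a i)) :=
        ((hu i).isUnit).map _
      have hval (i : ι) : β.isUnitSMul (fun i ↦ (hu i).isUnit) i =
          algebraMap K L (D i * (b : K) ^ a i) * β i := by
        rw [Module.Basis.isUnitSMul_apply, Algebra.smul_def]
      obtain ⟨δ, hδ, hδe⟩ := relativeDiscriminant_mem (β.isUnitSMul (fun i ↦ (hu i).isUnit))
        fun i ↦ by
          rw [hval i]
          exact (hG i).isIntegral_mul_root (hD i) b.isIntegral_coe hbα (hβ i)
      refine ⟨δ, hδ, ?_⟩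
      rw [hδe, show ⇑(β.isUnitSMul (fun i ↦ (hu i).isUnit)) =
        fun i ↦ algebraMap K L (D i * (b : K) ^ a i) * β i from funext hval, Algebra.discr_smul,
        Finset.prod_mul_distrib, Finset.prod_pow_eq_pow_sum, hθ, hN]
      ring
  -- The discriminant is the square of the determinant of all conjugates of the β_i. Row i consists
  -- of roots of the specialization of G_i at the conjugate of α, so the root bound applies row by
  -- row.
  have hplace (w : InfinitePlace K) : w θ ≤ c * max (w α) 1 ^ N := by
    let σ := w.embedding
    let _ : Algebra K ℂ := σ.toAlgebra
    have hcard : Fintype.card ι = Fintype.card (L →ₐ[K] ℂ) := by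
      rw [AlgHom.card, Module.finrank_eq_card_basis β]
    let e : ι ≃ (L →ₐ[K] ℂ) := Fintype.equivOfCardEq hcard
    have hdet := Algebra.discr_eq_det_embeddingsMatrixReindex_pow_two K ℂ β e
    have hentry (i j : ι) : ‖Algebra.embeddingsMatrixReindex K ℂ β e i j‖ ≤
        B i * max 1 ‖σ α‖ ^ a i := by
      have : Algebra.embeddingsMatrixReindex K ℂ β e i j = e j (β i) := rfl
      rw [this]
      refine hB i (σ.comp (algebraMap k K)) _ _ ?_
      have h1 := congrArg (e j) (hβ i)
      rw [map_zero, ← aeval_algHom_apply, ← eval_map_algebraMap, map_map] at h1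
      have h2 : (algebraMap K ℂ).comp (eval₂RingHom (algebraMap k K) α) =
          eval₂RingHom (σ.comp (algebraMap k K)) (σ α) := by
        ext
        · simp; rfl
        · simp; rfl
      rw [h2] at h1
      exact h1
    have h3 := Matrix.norm_det_le_of_norm_le hentry
    rw [Finset.prod_mul_distrib, Finset.prod_pow_eq_pow_sum] at h3
    rw [← InfinitePlace.norm_embedding_eq, ← InfinitePlace.norm_embedding_eq w α]
    change ‖σ θ‖ ≤ c * max ‖σ α‖ 1 ^ N
    have h4 : σ θ = (∏ i, (D i : ℂ)) ^ 2 *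
        (Algebra.embeddingsMatrixReindex K ℂ β e).det ^ 2 := by
      rw [← hdet, hθ]
      simp
      left; rfl
    rw [h4, norm_mul, norm_pow, norm_pow, norm_prod, hc, max_comm]
    simp only [Complex.norm_natCast]
    rw [mul_assoc, hN, mul_comm 2, pow_mul]
    refine mul_le_mul_of_nonneg_left ?_ (by positivity)
    rw [← mul_pow]
    exact pow_le_pow_left₀ (norm_nonneg _) (by linarith) 2
  have hnorm : |(Algebra.norm ℚ θ : ℝ)| ≤ c ^ Module.finrank ℚ K *
      (∏ w : InfinitePlace K, max (w α) 1 ^ w.mult) ^ N := by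
    have := InfinitePlace.prod_eq_abs_norm θ
    rw [Rat.cast_abs] at this
    rw [← this, ← InfinitePlace.sum_mult_eq, ← Finset.prod_pow_eq_pow_sum, ← Finset.prod_pow,
      ← Finset.prod_mul_distrib]
    refine Finset.prod_le_prod (fun _ _ ↦ by positivity) fun w _ ↦ ?_
    rw [← pow_mul, mul_comm _ N, pow_mul, ← mul_pow]
    exact pow_le_pow_left₀ (apply_nonneg _ _) (hplace w) _
  have hA : 0 < (∏ w : InfinitePlace K, max (w α) 1 ^ w.mult) ^ N := by positivity
  have hH : 0 ≤ mulHeight₁ α := by linarith [one_le_mulHeight₁ α]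
  have hfin : (Ideal.absNorm (relativeDiscriminant K L) : ℝ) ≤
      c ^ Module.finrank ℚ K * mulHeight₁ α ^ N := by
    -- The archimedean factor of the height occurs on the left of `key` and in the bound for the
    -- norm of θ, and cancels.
    refine le_of_mul_le_mul_right (key.trans ?_) hA
    calc _ ≤ mulHeight₁ α ^ N * _ := mul_le_mul_of_nonneg_left hnorm (by positivity)
      _ = _ := by ring
  have hn0 : Module.finrank ℚ K ≠ 0 := Module.finrank_pos.ne'
  calc normalizedDiscriminant K L
      ≤ (c ^ Module.finrank ℚ K * mulHeight₁ α ^ N) ^ ((Module.finrank ℚ K : ℝ)⁻¹) :=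
        Real.rpow_le_rpow (Nat.cast_nonneg _) hfin (by positivity)
    _ = c * absoluteHeight α ^ N := by
      rw [Real.mul_rpow (by positivity) (by positivity), Real.pow_rpow_inv_natCast hcpos.le hn0,
        absoluteHeight, ← Real.rpow_natCast, ← Real.rpow_mul hH, ← Real.rpow_natCast,
        ← Real.rpow_mul hH, mul_comm (N : ℝ)]

end IsWeighted

/-! ### Normality of the local rings of a smooth scheme. -/

open TensorProduct nonZeroDivisors in
/-- A domain which is étale over an integrally closed domain is integrally closed. -/
lemma IsIntegrallyClosed.of_etale (R S : Type*) [CommRing R] [IsDomain R] [IsIntegrallyClosed R]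
    [CommRing S] [IsDomain S] [Algebra R S] [Algebra.Etale R S] : IsIntegrallyClosed S := by
  let F := FractionRing R
  have hinj : Function.Injective (algebraMap R S) := by
    have := Module.Flat.isTorsionFree (R := R) (M := S)
    exact FaithfulSMul.algebraMap_injective R S
  have hle : Algebra.algebraMapSubmonoid S R⁰ ≤ S⁰ := by
    rintro _ ⟨r, hr, rfl⟩
    refine mem_nonZeroDivisors_of_ne_zero ?_
    exact (map_ne_zero_iff _ hinj).mpr (nonZeroDivisors.ne_zero hr)
  have hloc : IsLocalization (Algebra.algebraMapSubmonoid S R⁰) (S ⊗[R] F) := inferInstance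
  have hdom : IsDomain (S ⊗[R] F) := IsLocalization.isDomain_of_le_nonZeroDivisors _ hle
  -- The generic fibre is a domain, finite over F because it is unramified, hence a field.
  have hfield : IsField (S ⊗[R] F) := by
    let e := (Algebra.TensorProduct.comm R S F).toRingEquiv
    have : IsDomain (F ⊗[R] S) := MulEquiv.isDomain (S ⊗[R] F) e.symm.toMulEquiv
    have : Module.Finite F (F ⊗[R] S) := Algebra.FormallyUnramified.finite_of_free _ _
    exact e.toMulEquiv.isField (isField_of_isIntegral_of_isField' (Field.toIsField F))
  let _ : Field (S ⊗[R] F) := hfield.toField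
  have hSinj : Function.Injective (algebraMap S (S ⊗[R] F)) := IsLocalization.injective _ hle
  -- Integral closure commutes with smooth base change: the closure of S in S ⊗ F is S tensored with
  -- the closure of R in F, and the latter is R.
  have hcl (y : S ⊗[R] F) (hy : IsIntegral S y) : y ∈ (algebraMap S (S ⊗[R] F)).range := by
    obtain ⟨z, hz⟩ := (TensorProduct.toIntegralClosure_bijective_of_smooth (R := R) (S := S)
      (B := F)).2 ⟨y, hy⟩
    have hz' : ((TensorProduct.toIntegralClosure R S F z : integralClosure S (S ⊗[R] F)) :
        S ⊗[R] F) = y := congrArg Subtype.val hz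
    rw [← hz']
    clear hz hz'
    induction z with
    | zero => simp
    | add a b ha hb => rw [map_add]; exact add_mem ha hb
    | tmul s c =>
      obtain ⟨c, hc⟩ := c
      obtain ⟨r, rfl⟩ := IsIntegrallyClosed.isIntegral_iff.mp hc
      refine ⟨r • s, ?_⟩
      have : (TensorProduct.toIntegralClosure R S F (s ⊗ₜ ⟨algebraMap R F r, hc⟩) :
        S ⊗[R] F) = s ⊗ₜ algebraMap R F r := rfl
      rw [this, Algebra.TensorProduct.algebraMap_apply, Algebra.algebraMap_self, RingHom.id_apply,
        TensorProduct.smul_tmul, Algebra.smul_def, mul_one]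
  rw [isIntegrallyClosed_iff (FractionRing S)]
  intro x hx
  let f : FractionRing S →ₐ[S] S ⊗[R] F := IsFractionRing.liftAlgHom (g := Algebra.ofId S _) hSinj
  obtain ⟨s, hs⟩ := hcl (f x) (hx.map f)
  exact ⟨s, f.toRingHom.injective ((f.commutes s).trans hs)⟩

/-- The local rings of a smooth domain over a field are integrally closed. -/
lemma IsIntegrallyClosed.of_smooth (K S : Type*) [Field K] [CommRing S] [IsDomain S] [Algebra K S]
    [Algebra.Smooth K S] (p : Ideal S) [p.IsPrime] (T : Type*) [CommRing T] [Algebra S T]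
    [IsLocalization.AtPrime T p] : IsIntegrallyClosed T := by
  -- Near p the ring is étale over a polynomial ring over K, which is integrally closed.
  obtain ⟨f, hf, n, _, _, _⟩ := Algebra.IsSmoothAt.exists_isStandardEtale_mvPolynomial (R := K)
    (p := p)
  have hf0 : f ≠ 0 := fun h ↦ hf (h ▸ zero_mem p)
  have hle : Submonoid.powers f ≤ nonZeroDivisors S := powers_le_nonZeroDivisors_of_noZeroDivisors hf0
  have : IsDomain (Localization.Away f) := IsLocalization.isDomain_localization hle
  have hcl : IsIntegrallyClosed (Localization.Away f) :=
    .of_etale (MvPolynomial (Fin n) K) (Localization.Away f)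
  have hle2 : Submonoid.powers f ≤ p.primeCompl := by
    rw [Submonoid.powers_le]; exact hf
  let _ : Algebra (Localization.Away f) T :=
    IsLocalization.localizationAlgebraOfSubmonoidLe _ _ _ _ hle2
  have : IsScalarTower S (Localization.Away f) T :=
    IsLocalization.localization_isScalarTower_of_submonoid_le _ _ _ _ hle2
  have hloc := IsLocalization.isLocalization_of_submonoid_le (Localization.Away f) T _ _ hle2
  refine isIntegrallyClosed_of_isLocalization (R := Localization.Away f) T
    (p.primeCompl.map (algebraMap S (Localization.Away f))) ?_
  rintro _ ⟨s, hs, rfl⟩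
  refine mem_nonZeroDivisors_of_ne_zero ?_
  refine (map_ne_zero_iff _ (IsLocalization.injective _ hle)).mpr ?_
  rintro rfl
  exact hs (zero_mem p)

/-- The local rings of an integral scheme which is smooth over a field are integrally closed. -/
lemma AlgebraicGeometry.isIntegrallyClosed_stalk_of_smooth {K : Type u} [Field K] {X : Scheme.{u}}
    [IsIntegral X] (f : X ⟶ Spec (.of K)) [Smooth f] (x : X) :
    IsIntegrallyClosed (X.presheaf.stalk x) := by
  obtain ⟨_, ⟨V, hV, rfl⟩, hxV, -⟩ :=
    X.isBasis_affineOpens.exists_subset_of_mem_open (Set.mem_univ x) isOpen_univ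
  have hsm := f.smooth_appLE (isAffineOpen_top _) hV (by simp)
  let R₀ := Γ(Spec (.of K), ⊤)
  -- Smoothness is expressed over the global sections of Spec K, which are a field only through
  -- their isomorphism with K.
  have hR₀ : IsField R₀ :=
    (Scheme.ΓSpecIso (.of K)).commRingCatIsoToRingEquiv.toMulEquiv.isField (Field.toIsField K)
  let _ : Field R₀ := hR₀.toField
  let _ : Algebra R₀ Γ(X, V) := (f.appLE ⊤ V (by simp)).hom.toAlgebra
  have : Algebra.Smooth R₀ Γ(X, V) := hsm
  have : Nonempty V := ⟨⟨x, hxV⟩⟩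
  let _ := X.presheaf.algebra_section_stalk (⟨x, hxV⟩ : V)
  have := IsAffineOpen.isLocalization_stalk hV ⟨x, hxV⟩
  exact IsIntegrallyClosed.of_smooth R₀ Γ(X, V) (hV.primeIdealOf ⟨x, hxV⟩).asIdeal _

/-! ### The function field after extension of constants. -/

open nonZeroDivisors in
/-- A basis of `K` over `k` stays a basis after extension of scalars to a domain `A` over `k` and
passage to the fields of fractions. -/
lemma Module.Basis.exists_basis_fractionField {k K A B : Type*} [Field k] [Field K] [CommRing A]
    [IsDomain A] [CommRing B] [IsDomain B] [Algebra k K] [Algebra k A] [Algebra A B] [Algebra K B]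
    [Algebra k B] [IsScalarTower k A B] [IsScalarTower k K B] [Algebra.IsPushout k A K B]
    (F F' : Type*) [Field F] [Field F'] [Algebra A F] [IsFractionRing A F] [Algebra B F']
    [IsFractionRing B F'] [Algebra F F'] [Algebra A F'] [IsScalarTower A F F']
    [IsScalarTower A B F'] {ι : Type*} [Finite ι] (e : Basis ι k K) :
    ∃ b : Basis ι F F', ∀ i, b i = algebraMap B F' (algebraMap K B (e i)) := by
  have hbc : IsBaseChange A (IsScalarTower.toAlgHom k K B).toLinearMap := Algebra.IsPushout.out
  let b₀ : Basis ι A B := (e.baseChange A).map hbc.equiv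
  have hb₀ (i : ι) : b₀ i = algebraMap K B (e i) := by
    simp [b₀, IsBaseChange.equiv_tmul]
  have : Module.Finite A B := .of_basis b₀
  have : Module.Free A B := .of_basis b₀
  have : FaithfulSMul A B := inferInstance
  refine ⟨b₀.ofIsLocalizedModule F A⁰ (IsScalarTower.toAlgHom A B F').toLinearMap, fun i ↦ ?_⟩
  rw [Basis.ofIsLocalizedModule_apply, hb₀]
  rfl

namespace Curve

variable {k : Type u} [Field k] (C : Curve k) (K : Type u) [Field K] [Algebra k K]

lemma isPullback_baseChange_opens (U : C.X.Opens) :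
    IsPullback (C.baseChangeProj K ∣_ U) ((C.baseChangeProj K ⁻¹ᵁ U).ι ≫ (C.baseChange K).str)
      (U.ι ≫ C.str) (Spec.map (CommRingCat.ofHom (algebraMap k K))) :=
  (isPullback_morphismRestrict (C.baseChangeProj K) U).paste_vert
    (IsPullback.of_hasPullback C.str (Spec.map (CommRingCat.ofHom (algebraMap k K))))

/-- The functions on an affine open of `C` which are constant on `C`. -/
noncomputable def constants (U : C.X.Opens) : CommRingCat.of k ⟶ Γ(C.X, U) :=
  (Scheme.ΓSpecIso (.of k)).inv ≫ C.str.appLE ⊤ U (by simp)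

/-- The functions on the preimage of an affine open of `C` in the base change of `C` to `K` are
obtained from those on the affine open by extension of scalars. -/
lemma isPushout_baseChange_opens {U : C.X.Opens} (hU : IsAffineOpen U) :
    IsPushout (CommRingCat.ofHom (algebraMap k K)) (C.constants U)
      ((C.baseChange K).constants (C.baseChangeProj K ⁻¹ᵁ U)) ((C.baseChangeProj K).app U) := by
  have : IsAffine U := hU
  have := (isPushout_appTop_of_isPullback (C.isPullback_baseChange_opens K U)).flip
  refine this.of_iso (Scheme.ΓSpecIso (.of k)) (Scheme.ΓSpecIso (.of K)) U.topIso
    (Scheme.Opens.topIso _) ?_ ?_ ?_ ?_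
  · exact Scheme.ΓSpecIso_naturality _
  · simp only [constants, Scheme.Hom.comp_appTop, Scheme.Opens.ι_appTop,
      Scheme.Opens.topIso_hom, Scheme.Hom.appLE, Iso.hom_inv_id_assoc]
    exact (Category.assoc _ _ _).trans
      (congrArg (C.str.app ⊤ ≫ ·) (C.X.presheaf.map_comp _ _).symm)
  · simp only [constants, Scheme.Hom.comp_appTop, Scheme.Opens.ι_appTop,
      Scheme.Opens.topIso_hom, Scheme.Hom.appLE, Iso.hom_inv_id_assoc]
    exact (Category.assoc _ _ _).trans
      (congrArg ((C.baseChange K).str.app ⊤ ≫ ·) ((C.baseChange K).X.presheaf.map_comp _ _).symm)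
  · simp only [morphismRestrict_appTop, Scheme.Opens.topIso_hom]
    refine Eq.trans ?_ ((C.baseChangeProj K).naturality _).symm
    exact (Category.assoc _ _ _).trans
      (congrArg ((C.baseChangeProj K).app _ ≫ ·) ((C.baseChange K).X.presheaf.map_comp _ _).symm)
lemma preimage_fromSpecStalk_str (x : C.X) :
    Spec.preimage (C.X.fromSpecStalk x ≫ C.str) =
      (Scheme.ΓSpecIso (.of k)).inv ≫ C.str.appTop ≫ C.X.presheaf.germ ⊤ x trivial := by
  apply Spec.map_injective
  rw [Spec.map_preimage, Spec.map_comp, Spec.map_comp, ← Scheme.fromSpecStalk_toSpecΓ,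
    Category.assoc, Category.assoc, ← Scheme.toSpecΓ_naturality_assoc]
  simp

/-- Constants enter k(C) through the generic stalk; expressing them as germs of sections over U lets
the pushout square of section rings determine K(C) over k(C). -/
lemma algebraMap_eq_germ_constants (U : C.X.Opens) (hU : genericPoint C.X ∈ U) (a : k) :
    algebraMap k C.FunctionField a =
      C.X.presheaf.germ U (genericPoint C.X) hU (C.constants U a) := by
  have h : Spec.preimage (C.X.fromSpecStalk (genericPoint C.X) ≫ C.str) =
      C.constants U ≫ C.X.presheaf.germ U (genericPoint C.X) hU := by
    rw [preimage_fromSpecStalk_str, constants]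
    simp only [Scheme.Hom.appLE, Category.assoc, TopCat.Presheaf.germ_res]
    rfl
  exact congrArg (fun f ↦ f.hom a) h

lemma functionFieldMap_germ (U : C.X.Opens) (hU : genericPoint C.X ∈ U)
    (hV : genericPoint (C.baseChange K).X ∈ C.baseChangeProj K ⁻¹ᵁ U) (s : Γ(C.X, U)) :
    C.functionFieldMap K (C.X.presheaf.germ U (genericPoint C.X) hU s) =
      (C.baseChange K).X.presheaf.germ (C.baseChangeProj K ⁻¹ᵁ U) (genericPoint (C.baseChange K).X)
        hV ((C.baseChangeProj K).app U s) := by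
  have h : C.X.presheaf.germ U (genericPoint C.X) hU ≫ C.X.presheaf.stalkSpecializes
      (specializes_of_eq (C.baseChangeProj_genericPoint K)) ≫
        (C.baseChangeProj K).stalkMap (genericPoint (C.baseChange K).X) =
      (C.baseChangeProj K).app U ≫ (C.baseChange K).X.presheaf.germ (C.baseChangeProj K ⁻¹ᵁ U)
        (genericPoint (C.baseChange K).X) hV := by
    rw [TopCat.Presheaf.germ_stalkSpecializes_assoc, Scheme.Hom.germ_stalkMap]
  exact congrArg (fun f ↦ f.hom s) h

lemma functionFieldMap_algebraMap (a : k) :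
    C.functionFieldMap K (algebraMap k C.FunctionField a) =
      algebraMap K (C.baseChange K).FunctionField (algebraMap k K a) := by
  obtain ⟨_, ⟨U, hU, rfl⟩, hxU, -⟩ :=
    C.X.isBasis_affineOpens.exists_subset_of_mem_open (Set.mem_univ (genericPoint C.X)) isOpen_univ
  have hV : genericPoint (C.baseChange K).X ∈ C.baseChangeProj K ⁻¹ᵁ U := by
    change C.baseChangeProj K (genericPoint (C.baseChange K).X) ∈ U
    rwa [C.baseChangeProj_genericPoint K]
  rw [C.algebraMap_eq_germ_constants U hxU, C.functionFieldMap_germ K U hxU hV,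
    (C.baseChange K).algebraMap_eq_germ_constants _ hV]
  have := congrArg (fun f ↦ f.hom a) (C.isPushout_baseChange_opens K hU).w
  exact congrArg _ this.symm

/-- A basis of `K` over `k` is also a basis of `K(C)` over `k(C)`. -/
lemma exists_basis_baseChange {ι : Type*} [Finite ι] (e : Module.Basis ι k K) :
    let _ : Algebra C.FunctionField (C.baseChange K).FunctionField :=
      (C.functionFieldMap K).toAlgebra
    ∃ b : Module.Basis ι C.FunctionField (C.baseChange K).FunctionField,
      ∀ i, b i = algebraMap K _ (e i) := by
  intro _
  obtain ⟨_, ⟨U, hU, rfl⟩, hxU, -⟩ :=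
    C.X.isBasis_affineOpens.exists_subset_of_mem_open (Set.mem_univ (genericPoint C.X)) isOpen_univ
  set V := C.baseChangeProj K ⁻¹ᵁ U with hVU
  have hxV : genericPoint (C.baseChange K).X ∈ V := by
    change C.baseChangeProj K (genericPoint (C.baseChange K).X) ∈ U
    rwa [C.baseChangeProj_genericPoint K]
  have : Nonempty U := ⟨⟨_, hxU⟩⟩
  have : Nonempty V := ⟨⟨_, hxV⟩⟩
  have : IsAffineHom (C.baseChangeProj K) :=
    isAffineHom_isStableUnderBaseChange.of_isPullback (IsPullback.of_hasPullback C.str _).flip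
      inferInstance
  have hV : IsAffineOpen V := hU.preimage _
  let _ : Algebra k Γ(C.X, U) := (C.constants U).hom.toAlgebra
  let _ : Algebra K Γ((C.baseChange K).X, V) := ((C.baseChange K).constants V).hom.toAlgebra
  let _ : Algebra Γ(C.X, U) Γ((C.baseChange K).X, V) := ((C.baseChangeProj K).app U).hom.toAlgebra
  let _ : Algebra k Γ((C.baseChange K).X, V) :=
    (C.constants U ≫ (C.baseChangeProj K).app U).hom.toAlgebra
  let _ : Algebra Γ(C.X, U) C.FunctionField :=
    (C.X.germToFunctionField U).hom.toAlgebra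
  let _ : Algebra Γ((C.baseChange K).X, V) (C.baseChange K).FunctionField :=
    ((C.baseChange K).X.germToFunctionField V).hom.toAlgebra
  let _ : Algebra Γ(C.X, U) (C.baseChange K).FunctionField :=
    ((C.functionFieldMap K).comp (algebraMap Γ(C.X, U) C.FunctionField)).toAlgebra
  have hpush := C.isPushout_baseChange_opens K hU
  have : IsScalarTower k Γ(C.X, U) Γ((C.baseChange K).X, V) := .of_algebraMap_eq' rfl
  have : IsScalarTower k K Γ((C.baseChange K).X, V) :=
    .of_algebraMap_eq' (congrArg CommRingCat.Hom.hom hpush.w).symm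
  have : Algebra.IsPushout k Γ(C.X, U) K Γ((C.baseChange K).X, V) :=
    CommRingCat.isPushout_iff_isPushout.mp hpush.flip
  have : IsScalarTower Γ(C.X, U) C.FunctionField (C.baseChange K).FunctionField :=
    .of_algebraMap_eq' rfl
  have : IsScalarTower Γ(C.X, U) Γ((C.baseChange K).X, V) (C.baseChange K).FunctionField :=
    .of_algebraMap_eq fun s ↦ C.functionFieldMap_germ K U hxU hxV s
  have : IsFractionRing Γ(C.X, U) C.FunctionField :=
    functionField_isFractionRing_of_isAffineOpen _ U hU
  have : IsFractionRing Γ((C.baseChange K).X, V) (C.baseChange K).FunctionField :=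
    functionField_isFractionRing_of_isAffineOpen _ V hV
  obtain ⟨b, hb⟩ := e.exists_basis_fractionField (A := Γ(C.X, U)) (B := Γ((C.baseChange K).X, V))
    C.FunctionField (C.baseChange K).FunctionField
  exact ⟨b, fun i ↦ (hb i).trans ((C.baseChange K).algebraMap_eq_germ_constants V hxV _).symm⟩

lemma isIntegrallyClosed_stalk (x : C.X) : IsIntegrallyClosed (C.X.presheaf.stalk x) :=
  isIntegrallyClosed_stalk_of_smooth C.str x

/-- The constants, as elements of the local ring at a point. -/
noncomputable def stalkConstants (x : C.X) : k →+* C.X.presheaf.stalk x :=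
  (Spec.preimage (C.X.fromSpecStalk x ≫ C.str)).hom

lemma algebraMap_stalkConstants (x : C.X) (a : k) :
    algebraMap (C.X.presheaf.stalk x) C.X.functionField (C.stalkConstants x a) =
      algebraMap k C.FunctionField a := by
  have h : Spec.preimage (C.X.fromSpecStalk x ≫ C.str) ≫ C.X.presheaf.stalkSpecializes
      ((genericPoint_spec C.X).specializes trivial) =
      Spec.preimage (C.X.fromSpecStalk (genericPoint C.X) ≫ C.str) := by
    apply Spec.map_injective
    rw [Spec.map_comp, Spec.map_preimage, Spec.map_preimage,
      Scheme.SpecMap_stalkSpecializes_fromSpecStalk_assoc]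
  exact congrArg (fun f ↦ f.hom a) h

lemma Point.eval_stalkConstants {C : Curve k} {L : Type u} [Field L] [Algebra k L] (P : C.Point L)
    (a : k) : P.eval (C.stalkConstants P.pt a) = algebraMap k L a := by
  have h : Spec.preimage (C.X.fromSpecStalk (P.hom (IsLocalRing.closedPoint L)) ≫ C.str) ≫
      Scheme.stalkClosedPointTo P.hom =
      CommRingCat.ofHom (algebraMap k L) := by
    apply Spec.map_injective
    rw [Spec.map_comp, Spec.map_preimage, ← P.hom_str]
    exact Scheme.Spec_stalkClosedPointTo_fromSpecStalk_assoc _ _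
  exact congrArg (fun f ↦ f.hom a) h

end Curve

/-! ### Functions with bounded poles and their weighted equations. -/

section PoleBounded

open Polynomial IntermediateField

open scoped IntermediateField.algebraAdjoinAdjoin

variable {K E : Type*} [Field K] [Field E] [Algebra K E]

/-- The element `w` is integral over `K[t]`, and its poles at the poles of `t` have at most `a` times
the order of those of `t`. -/
def PoleBounded (K : Type*) {E : Type*} [Field K] [Field E] [Algebra K E] (t : E) (a : ℕ) (w : E) :
    Prop :=
  IsIntegral (Algebra.adjoin K {t}) w ∧ IsIntegral (Algebra.adjoin K {t⁻¹}) (w * t⁻¹ ^ a)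

/-- The case a = 0 is what saves one factor and gives d - 1 in the exponent. -/
lemma PoleBounded.one (t : E) (a : ℕ) : PoleBounded K t a 1 := by
  refine ⟨isIntegral_one, ?_⟩
  rw [one_mul]
  exact (isIntegral_algebraMap (R := Algebra.adjoin K {t⁻¹})
    (x := ⟨t⁻¹, Algebra.self_mem_adjoin_singleton K _⟩)).pow a

/-- An element which is integral over `S` is integral over `R` if the image of `S` is. -/
lemma IsIntegral.trans_of_forall {R S A : Type*} [CommRing R] [CommRing S] [CommRing A]
    [Nontrivial A] [Algebra R A] [Algebra S A] (h : ∀ s : S, IsIntegral R (algebraMap S A s)) {x : A}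
    (hx : IsIntegral S x) : IsIntegral R x := by
  obtain ⟨p, hp, hpx⟩ := hx
  refine IsIntegral.of_aeval_monic_of_isIntegral_coeff (p := p.map (algebraMap S A)) (hp.map _) ?_ ?_
    fun i ↦ by rw [coeff_map]; exact h _
  · intro h0
    rw [hp.natDegree_map] at h0
    rw [hp.natDegree_eq_zero.mp h0] at hpx
    simp at hpx
  · rw [Polynomial.eval_map, hpx]; exact isIntegral_zero

lemma isIntegrallyClosed_adjoin_of_transcendental {t : E} (ht : Transcendental K t) :
    IsIntegrallyClosed (Algebra.adjoin K {t}) :=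
  .of_equiv (Polynomial.algEquivOfTranscendental K t ht).toRingEquiv

/-- The minimal polynomial over `K(t)` of an element which is integral over `K[t]`. -/
lemma exists_minpoly_coeff_eq {t : E} (ht : Transcendental K t) {F : IntermediateField K E}
    (hF : F = K⟮t⟯) {w : E} (hw : IsIntegral (Algebra.adjoin K {t}) w) :
    IsIntegral F w ∧ ∃ p : K[X][X], p.Monic ∧ p.natDegree = (minpoly F w).natDegree ∧
      ∀ j, aeval t (p.coeff j) = algebraMap F E ((minpoly F w).coeff j) := by
  -- Keeping `F` free in the statement lets one field K(t) = K(t⁻¹) be used for both t and t⁻¹.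
  subst hF
  have := isIntegrallyClosed_adjoin_of_transcendental ht
  have hmin : minpoly K⟮t⟯ w = (minpoly (Algebra.adjoin K {t}) w).map _ :=
    minpoly.isIntegrallyClosed_eq_field_fractions (S := E) K⟮t⟯ E hw
  let e := Polynomial.algEquivOfTranscendental K t ht
  have hmon := minpoly.monic hw
  refine ⟨hw.tower_top, (minpoly (Algebra.adjoin K {t}) w).map e.symm.toRingEquiv.toRingHom,
    hmon.map _, ?_, fun j ↦ ?_⟩
  · rw [hmon.natDegree_map, hmin, hmon.natDegree_map]
  · rw [hmin, coeff_map, coeff_map]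
    have h (z : Algebra.adjoin K {t}) : aeval t (e.symm z) = (z : E) := by
      obtain ⟨q, rfl⟩ := e.surjective z
      rw [AlgEquiv.symm_apply_apply]
      simp [e]
    exact h _

/-- Reversing e turns the hypothesis into an identity between polynomials in the transcendental t,
where degrees can be compared. -/
lemma natDegree_le_of_aeval_inv {t : E} (ht : Transcendental K t) {c e : K[X]} {N : ℕ}
    (h : aeval t⁻¹ e = aeval t c * t⁻¹ ^ N) : c.natDegree ≤ N := by
  have ht0 : t ≠ 0 := by
    rintro rfl; exact ht isAlgebraic_zero
  by_cases hc : c = 0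
  · simp [hc]
  let _ : Invertible t⁻¹ := invertibleOfNonzero (inv_ne_zero ht0)
  have h1 := eval₂_reverse_mul_pow (algebraMap K E) t⁻¹ e
  rw [invOf_eq_inv, inv_inv] at h1
  change aeval t e.reverse * _ = aeval t⁻¹ e at h1
  have h2 : aeval t (e.reverse * X ^ N) = aeval t (c * X ^ e.natDegree) := by
    rw [h] at h1
    simp only [map_mul, map_pow, aeval_X]
    rw [inv_pow, inv_pow] at h1
    field_simp at h1
    linear_combination h1
  have h3 := transcendental_iff_injective.mp ht h2
  have h4 : (c * X ^ e.natDegree).natDegree = c.natDegree + e.natDegree :=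
    natDegree_mul_X_pow _ hc
  have h5 : (e.reverse * X ^ N).natDegree ≤ e.natDegree + N :=
    natDegree_mul_le.trans (add_le_add (reverse_natDegree_le e) (natDegree_X_pow_le N))
  rw [h3, h4] at h5
  omega

/-- The minimal polynomial of w t^(-a) is that of w with the coefficient of Y^j multiplied by
t^(-a(n-j)). These products lie in K[t⁻¹] while the coefficients lie in K[t], which bounds their
degrees. -/
lemma PoleBounded.exists_isWeighted {t : E} (ht : Transcendental K t) {a : ℕ} {w : E}
    (hw : PoleBounded K t a w) :
    ∃ G : K[X][X], IsWeighted a G ∧ aeval w (G.map (eval₂RingHom (algebraMap K E) t)) = 0 := by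
  have ht0 : t ≠ 0 := by
    rintro rfl; exact ht isAlgebraic_zero
  have ht' : Transcendental K t⁻¹ := fun h ↦ ht (by simpa using h.inv)
  have hF : K⟮t⟯ = K⟮t⁻¹⟯ := by
    apply le_antisymm
    · rw [adjoin_simple_le_iff]
      simpa using inv_mem (mem_adjoin_simple_self K t⁻¹)
    · rw [adjoin_simple_le_iff]
      exact inv_mem (mem_adjoin_simple_self K t)
  obtain ⟨hint, p, hpm, hpd, hp⟩ := exists_minpoly_coeff_eq ht rfl hw.1
  obtain ⟨-, q, hqm, hqd, hq⟩ := exists_minpoly_coeff_eq ht' hF hw.2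
  set s : K⟮t⟯ := (AdjoinSimple.gen K t)⁻¹ ^ a with hs
  have hs0 : s ≠ 0 := by
    refine pow_ne_zero _ (inv_ne_zero fun h ↦ ht0 ?_)
    simpa using congrArg (algebraMap K⟮t⟯ E) h
  have hsE : algebraMap K⟮t⟯ E s = t⁻¹ ^ a := by simp [hs]
  have hsm : w * t⁻¹ ^ a = s • w := by rw [Algebra.smul_def, hsE, mul_comm]
  rw [hsm, IsIntegrallyClosed.minpoly_smul hs0 hint] at hq
  refine ⟨p, ⟨hpm, fun j ↦ ?_⟩, ?_⟩
  · refine natDegree_le_of_aeval_inv ht (e := q.coeff j) ?_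
    rw [hq, coeff_scaleRoots, map_mul, map_pow, hsE, hp, hpd, ← pow_mul, mul_comm a]
  · have : p.map (eval₂RingHom (algebraMap K E) t) = (minpoly K⟮t⟯ w).map (algebraMap K⟮t⟯ E) := by
      ext j
      rw [coeff_map, coeff_map, ← hp]
      rfl
    rw [this, aeval_map_algebraMap]
    exact minpoly.aeval _ _

/-- An element which is integral over `K[t]` is a root of a weighted polynomial. -/
lemma exists_isWeighted_of_isIntegral {t : E} (ht : Transcendental K t) {w : E}
    (hw : IsIntegral (Algebra.adjoin K {t}) w) :
    ∃ (a : ℕ) (G : K[X][X]), IsWeighted a G ∧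
      aeval w (G.map (eval₂RingHom (algebraMap K E) t)) = 0 := by
  obtain ⟨-, p, hpm, hpd, hp⟩ := exists_minpoly_coeff_eq ht rfl hw
  refine ⟨p.support.sup fun j ↦ (p.coeff j).natDegree, p, ⟨hpm, fun j ↦ ?_⟩, ?_⟩
  · rcases lt_or_ge j p.natDegree with hj | hj
    · by_cases h0 : p.coeff j = 0
      · simp [h0]
      · calc _ ≤ p.support.sup fun j ↦ (p.coeff j).natDegree :=
            Finset.le_sup (f := fun j ↦ (p.coeff j).natDegree) (mem_support_iff.mpr h0)
          _ ≤ _ := Nat.le_mul_of_pos_left _ (by omega)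
    · rcases hj.eq_or_lt with hj | hj
      · rw [← hj, show p.coeff p.natDegree = 1 from hpm, natDegree_one]; exact Nat.zero_le _
      · rw [coeff_eq_zero_of_natDegree_lt hj, natDegree_zero]; exact Nat.zero_le _
  · have : p.map (eval₂RingHom (algebraMap K E) t) = (minpoly K⟮t⟯ w).map (algebraMap K⟮t⟯ E) := by
      ext j
      rw [coeff_map, coeff_map, ← hp]
      rfl
    rw [this, aeval_map_algebraMap]
    exact minpoly.aeval _ _

end PoleBounded

/-! ### Descent of pole-bounded functions from K to k. -/

section ScalarExtension

open Polynomial IntermediateField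

variable {k K E E' ι : Type*} [Field k] [Field K] [Field E] [Field E'] [Algebra k K] [Algebra k E]
  [Algebra K E'] [Algebra E E'] [Algebra k E'] [IsScalarTower k K E'] [IsScalarTower k E E']
  [Fintype ι] {e : Module.Basis ι k K} {b : Module.Basis ι E E'}

lemma repr_algebraMap_of_basis (hb : ∀ i, b i = algebraMap K E' (e i)) (x : K) (i : ι) :
    b.repr (algebraMap K E' x) i = algebraMap k E (e.repr x i) := by
  classical
  have : algebraMap K E' x = ∑ j, algebraMap k E (e.repr x j) • b j := by
    conv_lhs => rw [← e.sum_repr x]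
    rw [map_sum]
    refine Finset.sum_congr rfl fun j _ ↦ ?_
    rw [Algebra.smul_def, Algebra.smul_def, map_mul, hb, ← IsScalarTower.algebraMap_apply,
      ← IsScalarTower.algebraMap_apply]
  rw [this, b.repr_sum_self]

lemma trace_algebraMap_of_basis (hb : ∀ i, b i = algebraMap K E' (e i)) (x : K) :
    Algebra.trace E E' (algebraMap K E' x) = algebraMap k E (Algebra.trace k K x) := by
  classical
  rw [Algebra.trace_eq_matrix_trace b, Algebra.trace_eq_matrix_trace e, Matrix.trace, Matrix.trace,
    map_sum]
  refine Finset.sum_congr rfl fun i _ ↦ ?_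
  rw [Matrix.diag_apply, Matrix.diag_apply, Algebra.leftMulMatrix_eq_repr_mul,
    Algebra.leftMulMatrix_eq_repr_mul, hb, ← map_mul, repr_algebraMap_of_basis hb]

/-- The element x belongs to the trace-dual basis of e over k. Writing coordinates as traces shows
that they preserve integrality. -/
lemma exists_repr_eq_trace [CharZero k] (hb : ∀ i, b i = algebraMap K E' (e i)) (i : ι) :
    ∃ x : K, ∀ w : E', b.repr w i = Algebra.trace E E' (algebraMap K E' x * w) := by
  classical
  have : Module.Finite k K := .of_basis e
  refine ⟨(Algebra.traceForm k K).dualBasis (traceForm_nondegenerate k K) e i, fun w ↦ ?_⟩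
  conv_rhs => rw [← b.sum_repr w]
  rw [Finset.mul_sum, map_sum]
  have h (j : ι) : Algebra.trace E E' (algebraMap K E' ((Algebra.traceForm k K).dualBasis
      (traceForm_nondegenerate k K) e i) * b.repr w j • b j) =
        if j = i then b.repr w j else 0 := by
    rw [mul_smul_comm, map_smul, hb, ← map_mul, trace_algebraMap_of_basis hb]
    have := LinearMap.BilinForm.apply_dualBasis_left
      (traceForm_nondegenerate k K) e i j
    rw [Algebra.traceForm_apply] at this
    rw [this]
    split_ifs <;> simp
  rw [Finset.sum_congr rfl fun j _ ↦ h j]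
  simp

lemma isIntegral_of_isIntegral_adjoin [Algebra.IsAlgebraic k K] {t : E} {w : E'}
    (hw : IsIntegral (Algebra.adjoin K {algebraMap E E' t}) w) :
    IsIntegral (Algebra.adjoin k {t}) w := by
  refine IsIntegral.trans_of_forall (fun s ↦ ?_) hw
  obtain ⟨s, hs⟩ := s
  change IsIntegral _ s
  induction hs using Algebra.adjoin_induction with
  | mem x hx =>
    obtain rfl : x = _ := hx
    exact isIntegral_algebraMap (R := Algebra.adjoin k {t}) (A := E')
      (x := ⟨t, Algebra.self_mem_adjoin_singleton k t⟩)
  | algebraMap r =>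
    have h : IsIntegral k (algebraMap K E' r) :=
      (Algebra.IsAlgebraic.isAlgebraic r).isIntegral.map (IsScalarTower.toAlgHom k K E')
    exact h.tower_top
  | add x y _ _ hx hy => exact hx.add hy
  | mul x y _ _ hx hy => exact hx.mul hy

/-- The coordinates of an integral element with respect to a basis of constants are integral. -/
lemma isIntegral_repr [CharZero k] (hb : ∀ i, b i = algebraMap K E' (e i)) {t : E} {w : E'}
    (hw : IsIntegral (Algebra.adjoin k {t}) w) (i : ι) :
    IsIntegral (Algebra.adjoin k {t}) (b.repr w i) := by
  have : Module.Finite k K := .of_basis e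
  have : Module.Finite E E' := .of_basis b
  obtain ⟨x, hx⟩ := exists_repr_eq_trace hb i
  rw [hx]
  have h : IsIntegral k (algebraMap K E' x) :=
    (Algebra.IsIntegral.isIntegral x).map (IsScalarTower.toAlgHom k K E')
  exact Algebra.isIntegral_trace (h.tower_top.mul hw)

/-- Since t lies in the smaller field, multiplication by t^(-a) commutes with taking coordinates, so
both integrality conditions descend. -/
lemma PoleBounded.repr [CharZero k] (hb : ∀ i, b i = algebraMap K E' (e i)) {t : E} {w : E'} {a : ℕ}
    (hw : PoleBounded K (algebraMap E E' t) a w) (i : ι) : PoleBounded k t a (b.repr w i) := by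
  have : Module.Finite k K := .of_basis e
  refine ⟨isIntegral_repr hb (isIntegral_of_isIntegral_adjoin hw.1) i, ?_⟩
  have h2 := hw.2
  rw [← map_inv₀] at h2
  have h3 := isIntegral_repr hb (isIntegral_of_isIntegral_adjoin h2) i
  have : w * algebraMap E E' t⁻¹ ^ a = (t⁻¹ ^ a) • w := by
    rw [Algebra.smul_def, map_pow, mul_comm]
  rwa [this, map_smul, Finsupp.smul_apply, smul_eq_mul, mul_comm] at h3

/-- If the pole-bounded functions span after an extension of constants, then they span. -/
theorem span_poleBounded_eq_top_of_basis [CharZero k] (hb : ∀ i, b i = algebraMap K E' (e i)) {t : E}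
    [FiniteDimensional k⟮t⟯ E] {a : ℕ}
    (h : Submodule.span K⟮algebraMap E E' t⟯ {w | PoleBounded K (algebraMap E E' t) a w} = ⊤) :
    Submodule.span k⟮t⟯ {w | PoleBounded k t a w} = ⊤ := by
  have : Module.Finite k K := .of_basis e
  have : Module.Finite E E' := .of_basis b
  have : FiniteDimensional k⟮t⟯ E' := .trans k⟮t⟯ E E'
  set W := Submodule.span k⟮t⟯ {w | PoleBounded k t a w} with hW
  -- S consists of the multipliers preserving the elements with all coordinates in W. It contains K
  -- and t, and it is closed under inverses because E' is algebraic over k(t); hence it contains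
  -- K(t).
  let S : Subalgebra k⟮t⟯ E' :=
    { carrier := {z | ∀ w : E', (∀ i, b.repr w i ∈ W) → ∀ i, b.repr (z * w) i ∈ W}
      mul_mem' := fun {x y} hx hy w hw ↦ by rw [mul_assoc]; exact hx _ (hy _ hw)
      add_mem' := fun {x y} hx hy w hw i ↦ by
        rw [add_mul, map_add]; exact add_mem (hx w hw i) (hy w hw i)
      algebraMap_mem' := fun r w hw i ↦ by
        rw [IsScalarTower.algebraMap_apply k⟮t⟯ E E', ← Algebra.smul_def, map_smul]
        exact W.smul_mem r (hw i) }
  have hSmem (z : E') : z ∈ S ↔ ∀ w : E', (∀ i, b.repr w i ∈ W) → ∀ i, b.repr (z * w) i ∈ W :=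
    Iff.rfl
  have hSinv (z : E') (hz : z ∈ S) : z⁻¹ ∈ S :=
    S.inv_mem_of_algebraic (x := ⟨z, hz⟩) (Algebra.IsAlgebraic.isAlgebraic z)
  have hSK (x : K) : algebraMap K E' x ∈ S := by
    rw [hSmem]
    intro w hw i
    have : algebraMap K E' x * w = ∑ j, b.repr w j • algebraMap K E' (x * e j) := by
      conv_lhs => rw [← b.sum_repr w]
      rw [Finset.mul_sum]
      refine Finset.sum_congr rfl fun j _ ↦ ?_
      rw [map_mul, hb, mul_smul_comm]
    rw [this, map_sum, Finsupp.finsetSum_apply]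
    refine sum_mem fun j _ ↦ ?_
    rw [map_smul, Finsupp.smul_apply, repr_algebraMap_of_basis hb, smul_eq_mul, mul_comm]
    exact W.smul_mem (algebraMap k k⟮t⟯ _) (hw j)
  have hSt : algebraMap E E' t ∈ S := by
    rw [hSmem]
    intro w hw i
    rw [← Algebra.smul_def, map_smul]
    exact W.smul_mem (AdjoinSimple.gen k t) (hw i)
  have hadj : ∀ z ∈ K⟮algebraMap E E' t⟯, z ∈ S := by
    intro z hz
    induction hz using adjoin_induction with
    | mem x hx =>
      obtain rfl : x = _ := hx
      exact hSt
    | algebraMap x => exact hSK x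
    | add x y _ _ hx hy => exact add_mem hx hy
    | inv x _ hx => exact hSinv x hx
    | mul x y _ _ hx hy => exact mul_mem hx hy
  have hall (w : E') : ∀ i, b.repr w i ∈ W := by
    have hw : w ∈ Submodule.span K⟮algebraMap E E' t⟯
      {w | PoleBounded K (algebraMap E E' t) a w} := h ▸ Submodule.mem_top
    induction hw using Submodule.span_induction with
    | mem x hx => exact fun i ↦ Submodule.subset_span (PoleBounded.repr hb hx i)
    | zero => intro i; simp
    | add x y _ _ hx hy => intro i; rw [map_add]; exact add_mem (hx i) (hy i)
    | smul z x _ hx => exact (hSmem _).mp (hadj z z.2) x hx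
  rw [eq_top_iff]
  intro y _
  -- Every y in E is a coordinate of y times a basis vector.
  have hne : Nonempty ι := b.index_nonempty
  have := hall (y • b hne.some) hne.some
  simpa using this

end ScalarExtension

/-! ### Truncations of the equation of x over K(t). -/

section Span

open Polynomial IntermediateField

open scoped IntermediateField.algebraAdjoinAdjoin

variable {K E : Type*} [Field K] [Field E] [Algebra K E]

/-- The truncations of an equation for `x` with coefficients in `R` are integral over `R`. -/
lemma isIntegral_truncation (R : Subalgebra K E) {c : ℕ → E} (hc : ∀ j, c j ∈ R) {x : E} {n : ℕ}
    (hn : 0 < n) (h : ∑ j ∈ Finset.range (n + 1), c j * x ^ j = 0) (s : ℕ) :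
    IsIntegral R (∑ j ∈ Finset.Ioc s n, c j * x ^ (j - s)) := by
  -- The truncation maps the span of 1, ..., x^(n-1) to itself: on x^i with i < s the exponents stay
  -- below n, and for i ≥ s the equation replaces the upper part by the lower one.
  set N : Submodule R E := Submodule.span R ((fun i ↦ x ^ i) '' Set.Iio n) with hN
  have hpow (i : ℕ) (hi : i < n) : x ^ i ∈ N := Submodule.subset_span ⟨i, hi, rfl⟩
  have hterm (j i : ℕ) (hi : i < n) : c j * x ^ i ∈ N := by
    have := N.smul_mem (⟨c j, hc j⟩ : R) (hpow i hi)
    rwa [Algebra.smul_def] at this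
  refine isIntegral_of_smul_mem_submodule N ?_ ?_ _ ?_
  · intro h0
    have := hpow 0 hn
    rw [h0] at this
    simp at this
  · exact Submodule.fg_span ((Set.finite_Iio n).image _)
  · intro y hy
    induction hy using Submodule.span_induction with
    | zero => simp
    | add y z _ _ hy hz => rw [smul_add]; exact add_mem hy hz
    | smul r y _ hy => rw [smul_comm]; exact N.smul_mem r hy
    | mem y hy =>
      obtain ⟨i, hi, rfl⟩ := hy
      rw [Set.mem_Iio] at hi
      change (∑ j ∈ Finset.Ioc s n, c j * x ^ (j - s)) * x ^ i ∈ N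
      rcases lt_or_ge i s with his | his
      · rw [Finset.sum_mul]
        refine sum_mem fun j hj ↦ ?_
        rw [Finset.mem_Ioc] at hj
        rw [mul_assoc, ← pow_add]
        exact hterm _ _ (by omega)
      · have hsplit : ∑ j ∈ Finset.range (s + 1), c j * x ^ j +
            ∑ j ∈ Finset.Ioc s n, c j * x ^ j = 0 := by
          rw [← h, ← Finset.sum_range_add_sum_Ico _ (show s + 1 ≤ n + 1 by omega)]
          congr 1
          refine Finset.sum_congr ?_ fun _ _ ↦ rfl
          ext j; simp only [Finset.mem_Ioc, Finset.mem_Ico]; omega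
        have : (∑ j ∈ Finset.Ioc s n, c j * x ^ (j - s)) * x ^ i =
            -∑ j ∈ Finset.range (s + 1), c j * x ^ (j + (i - s)) := by
          have h1 : (∑ j ∈ Finset.Ioc s n, c j * x ^ (j - s)) * x ^ i =
              x ^ (i - s) * ∑ j ∈ Finset.Ioc s n, c j * x ^ j := by
            rw [Finset.sum_mul, Finset.mul_sum]
            refine Finset.sum_congr rfl fun j hj ↦ ?_
            rw [Finset.mem_Ioc] at hj
            rw [mul_left_comm, mul_assoc, ← pow_add, ← pow_add]
            congr 2; omega
          have h2 : ∑ j ∈ Finset.range (s + 1), c j * x ^ (j + (i - s)) =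
              x ^ (i - s) * ∑ j ∈ Finset.range (s + 1), c j * x ^ j := by
            rw [Finset.mul_sum]
            refine Finset.sum_congr rfl fun j _ ↦ ?_
            rw [pow_add]; ring
          rw [h1, h2]
          linear_combination x ^ (i - s) * hsplit
        rw [this]
        refine neg_mem (sum_mem fun j hj ↦ hterm _ _ ?_)
        rw [Finset.mem_range] at hj
        omega

lemma aeval_mul_inv_pow_mem {t : E} (ht0 : t ≠ 0) {p : K[X]} {m : ℕ} (hp : p.natDegree ≤ m) :
    aeval t p * t⁻¹ ^ m ∈ Algebra.adjoin K {t⁻¹} := by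
  rw [aeval_eq_sum_range, Finset.sum_mul]
  refine sum_mem fun l hl ↦ ?_
  rw [Finset.mem_range] at hl
  have : p.coeff l • t ^ l * t⁻¹ ^ m = p.coeff l • t⁻¹ ^ (m - l) := by
    rw [smul_mul_assoc, show m = l + (m - l) by omega, pow_add, ← mul_assoc, ← mul_pow,
      mul_inv_cancel₀ ht0, one_pow, one_mul, show l + (m - l) - l = m - l by omega]
  rw [this]
  exact Subalgebra.smul_mem _ (pow_mem (Algebra.self_mem_adjoin_singleton K _) _) _

lemma Polynomial.Bivariate.coeff_coeff_swap {R : Type*} [CommRing R] (p : R[X][X]) (i j : ℕ) :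
    ((Bivariate.swap p).coeff i).coeff j = (p.coeff j).coeff i := by
  induction p using Polynomial.induction_on' with
  | add p q hp hq => simp only [map_add, coeff_add, hp, hq]
  | monomial n f =>
    induction f using Polynomial.induction_on' with
    | add f g hf hg => simp only [map_add, coeff_add, hf, hg]
    | monomial l a =>
      rw [Bivariate.swap_monomial_monomial]
      simp only [coeff_monomial]
      split_ifs <;> simp_all [coeff_monomial]

lemma aevalAeval_eq_eval₂ (t x : E) (p : K[X][X]) :
    aevalAeval t x p = p.eval₂ (aeval t : K[X] →ₐ[K] E).toRingHom x := by
  have : (aevalAeval t x : K[X][X] →ₐ[K] E).toRingHom =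
      eval₂RingHom (aeval t : K[X] →ₐ[K] E).toRingHom x := by
    refine Polynomial.ringHom_ext (fun a ↦ ?_) ?_
    · simp
    · simp
  exact congrArg (fun f ↦ f p) this

/-- By Gauss's lemma G stays irreducible over K(x), so up to a scalar it is the minimal polynomial
of t, which generates E over K(x). This is how the degree m of x becomes the degree in t of the
relation. -/
lemma finrank_eq_natDegree_of_prime {x t : E} (hx : Transcendental K x) (hgen : adjoin K {x, t} = ⊤)
    {G : K[X][X]} (hG : Prime G) (h : aevalAeval x t G = 0) :
    Module.finrank K⟮x⟯ E = G.natDegree := by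
  have hdeg : G.natDegree ≠ 0 := by
    intro h0
    obtain ⟨c, rfl⟩ := natDegree_eq_zero.mp h0
    rw [aevalAeval_C] at h
    exact hG.ne_zero (by rw [(transcendental_iff.mp hx) c h, C_0])
  let ε := Polynomial.algEquivOfTranscendental K x hx
  let _ : Algebra K[X] K⟮x⟯ :=
    ((algebraMap (Algebra.adjoin K {x}) K⟮x⟯).comp ε.symm.toRingEquiv.symm.toRingHom).toAlgebra
  have hfrac : IsFractionRing K[X] K⟮x⟯ :=
    (IsFractionRing.isFractionRing_iff_of_base_ringEquiv (R := Algebra.adjoin K {x}) K⟮x⟯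
      ε.symm.toRingEquiv).mp inferInstance
  have hmap (p : K[X]) : algebraMap K⟮x⟯ E (algebraMap K[X] K⟮x⟯ p) = aeval x p := by
    change ((ε p : Algebra.adjoin K {x}) : E) = _
    simp [ε]
  have hirr := (hG.irreducible.isPrimitive
    hdeg).irreducible_iff_irreducible_map_fraction_map (K := K⟮x⟯) |>.mp hG.irreducible
  set q := G.map (algebraMap K[X] K⟮x⟯) with hq
  have hqd : q.natDegree = G.natDegree :=
    natDegree_map_eq_of_injective (IsFractionRing.injective K[X] K⟮x⟯) _
  have hq0 : aeval t q = 0 := by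
    rw [aeval_def, hq, eval₂_map, ← h, aevalAeval_eq_eval₂]
    congr 1
    ext p
    · simp [hmap]
    · simp [hmap]
  have hmin := minpoly.eq_of_irreducible hirr hq0
  have hint : IsIntegral K⟮x⟯ t := isAlgebraic_iff_isIntegral.mp ⟨q, hirr.ne_zero, hq0⟩
  have htop : K⟮x⟯⟮t⟯ = ⊤ := by
    apply restrictScalars_injective K
    rw [adjoin_adjoin_left, restrictScalars_top, ← hgen]
    rfl
  rw [← finrank_top', ← htop, adjoin.finrank hint, ← hmin, natDegree_mul_C, hqd]
  exact inv_ne_zero (leadingCoeff_ne_zero.mpr hirr.ne_zero)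

/-- If `E = K(t, x)`, then the functions with poles at most those of `t ^ m`, where
`m = [E : K(x)]`, span `E` over `K(t)`. -/
theorem span_poleBounded_eq_top {t x : E} (ht : Transcendental K t) (hx : Transcendental K x)
    (hgen : adjoin K {t, x} = ⊤) (halg : IsAlgebraic K⟮t⟯ x) {m : ℕ}
    (hm : Module.finrank K⟮x⟯ E = m) : Submodule.span K⟮t⟯ {w | PoleBounded K t m w} = ⊤ := by
  have ht0 : t ≠ 0 := by
    rintro rfl; exact ht isAlgebraic_zero
  let φ : K[X][X] →ₐ[K] E := aevalAeval t x
  have hker : RingHom.ker φ ≠ ⊥ := by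
    rw [← IsFractionRing.isAlgebraic_iff (Algebra.adjoin K {t})] at halg
    obtain ⟨p, hp0, hp⟩ := halg
    let ε := Polynomial.algEquivOfTranscendental K t ht
    have hε (z : Algebra.adjoin K {t}) : aeval t (ε.symm z) = (z : E) := by
      obtain ⟨q, rfl⟩ := ε.surjective z
      rw [AlgEquiv.symm_apply_apply]
      simp [ε]
    refine fun hbot ↦ hp0 ?_
    have hP : p.map ε.symm.toRingEquiv.toRingHom ∈ RingHom.ker φ := by
      rw [RingHom.mem_ker]
      change aevalAeval t x _ = 0
      rw [aevalAeval_eq_eval₂, eval₂_map, ← hp, aeval_def]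
      congr 1
      ext z
      exact hε z
    rw [hbot, Ideal.mem_bot] at hP
    exact (Polynomial.map_eq_zero_iff ε.symm.injective).mp hP
  -- F is an irreducible relation between t and x; exchanging its variables bounds the degrees of
  -- its coefficients in t by m.
  obtain ⟨F, hFker, hF⟩ := (RingHom.ker_isPrime φ).exists_mem_prime_of_ne_bot hker
  replace hFker : aevalAeval t x F = 0 := hFker
  have hG : Prime (Bivariate.swap F) :=
    (MulEquiv.prime_iff (Bivariate.swap (R := K)).toMulEquiv).mpr hF
  have hdegG := finrank_eq_natDegree_of_prime hx (t := t) (by rwa [Set.pair_comm]) hG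
    (by rw [Bivariate.aevalAeval_swap, hFker])
  rw [hm] at hdegG
  have hcoeff (j : ℕ) : (F.coeff j).natDegree ≤ m := by
    rw [natDegree_le_iff_coeff_eq_zero]
    intro l hl
    rw [← Polynomial.Bivariate.coeff_coeff_swap,
      coeff_eq_zero_of_natDegree_lt (show (Bivariate.swap F).natDegree < l by omega), coeff_zero]
  set n := F.natDegree with hn
  have hn0 : 0 < n := by
    rw [Nat.pos_iff_ne_zero]
    intro h0
    obtain ⟨c, rfl⟩ := natDegree_eq_zero.mp h0
    rw [aevalAeval_C] at hFker
    exact hF.ne_zero (by rw [(transcendental_iff.mp ht) c hFker, C_0])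
  set f : ℕ → E := fun j ↦ aeval t (F.coeff j) with hf
  have hsum : ∑ j ∈ Finset.range (n + 1), f j * x ^ j = 0 := by
    rw [aevalAeval_eq_eval₂, eval₂_eq_sum_range] at hFker
    exact hFker
  have hfn : f n ≠ 0 := by
    intro h0
    have := (transcendental_iff.mp ht) _ h0
    exact hF.ne_zero (leadingCoeff_eq_zero.mp this)
  -- The truncation lemma is used twice: over K[t], and over K[t⁻¹] after multiplying the equation
  -- by t^(-m).
  have hω (s : ℕ) : PoleBounded K t m (∑ j ∈ Finset.Ioc s n, f j * x ^ (j - s)) := by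
    refine ⟨isIntegral_truncation _ (fun j ↦ ?_) hn0 hsum s, ?_⟩
    · rw [Algebra.adjoin_singleton_eq_range_aeval]; exact ⟨_, rfl⟩
    · have := isIntegral_truncation (Algebra.adjoin K {t⁻¹}) (c := fun j ↦ f j * t⁻¹ ^ m) (x := x)
        (fun j ↦ aeval_mul_inv_pow_mem ht0 (hcoeff j)) hn0 (by
          rw [← zero_mul (t⁻¹ ^ m), ← hsum, Finset.sum_mul]
          exact Finset.sum_congr rfl fun _ _ ↦ by ring) s
      rw [Finset.sum_mul]
      rwa [Finset.sum_congr rfl fun j _ ↦ mul_right_comm (f j) (t⁻¹ ^ m) (x ^ (j - s))] at this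
  set W := Submodule.span K⟮t⟯ {w | PoleBounded K t m w} with hW
  have hfmem (j : ℕ) : f j ∈ K⟮t⟯ :=
    algebra_adjoin_le_adjoin K _
      (by rw [Algebra.adjoin_singleton_eq_range_aeval]; exact ⟨_, rfl⟩)
  have hmul {z y : E} (hz : z ∈ K⟮t⟯) (hy : y ∈ W) : z * y ∈ W := W.smul_mem (⟨z, hz⟩ : K⟮t⟯) hy
  have hdiv {y : E} (hy : f n * y ∈ W) : y ∈ W := by
    have := hmul (inv_mem (hfmem n)) hy
    rwa [inv_mul_cancel_left₀ hfn] at this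
  -- For 0 < i < n the truncation at s = n - i is f_n x^i plus lower powers of x; for i ≥ n the
  -- equation itself lowers the power.
  have hpow (i : ℕ) : x ^ i ∈ W := by
    induction i using Nat.strong_induction_on with
    | _ i ih =>
    rcases Nat.eq_zero_or_pos i with rfl | hi
    · rw [pow_zero]; exact Submodule.subset_span (PoleBounded.one t m)
    apply hdiv
    rcases lt_or_ge i n with hin | hin
    · have h1 : ∑ j ∈ Finset.Ioc (n - i) n, f j * x ^ (j - (n - i)) ∈ W :=
        Submodule.subset_span (hω _)
      obtain ⟨n', hn'⟩ : ∃ n', n = n' + 1 := ⟨n - 1, by omega⟩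
      rw [hn', Finset.sum_Ioc_succ_top (by omega), ← hn', show n - (n - i) = i by omega] at h1
      refine (Submodule.add_mem_iff_right W (sum_mem fun j hj ↦ ?_)).mp h1
      rw [Finset.mem_Ioc] at hj
      exact hmul (hfmem j) (ih _ (by omega))
    · have h1 : f n * x ^ i = -∑ j ∈ Finset.range n, f j * x ^ (j + (i - n)) := by
        rw [Finset.sum_range_succ] at hsum
        have h2 : ∑ j ∈ Finset.range n, f j * x ^ (j + (i - n)) =
            x ^ (i - n) * ∑ j ∈ Finset.range n, f j * x ^ j := by
          rw [Finset.mul_sum]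
          refine Finset.sum_congr rfl fun j _ ↦ ?_
          rw [pow_add]; ring
        rw [h2, show x ^ i = x ^ (i - n) * x ^ n by rw [← pow_add]; congr 1; omega]
        linear_combination x ^ (i - n) * hsum
      rw [h1]
      refine neg_mem (sum_mem fun j hj ↦ ?_)
      rw [Finset.mem_range] at hj
      exact hmul (hfmem j) (ih _ (by omega))
  have htop : K⟮t⟯⟮x⟯ = ⊤ := by
    apply restrictScalars_injective K
    rw [adjoin_adjoin_left, restrictScalars_top, ← hgen]
    rfl
  rw [eq_top_iff]
  intro y _
  have hy : y ∈ K⟮t⟯⟮x⟯.toSubalgebra := by rw [htop]; trivial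
  rw [adjoin_simple_toSubalgebra_of_isAlgebraic halg, Algebra.adjoin_singleton_eq_range_aeval] at hy
  obtain ⟨p, rfl⟩ := hy
  change aeval x p ∈ W
  rw [aeval_eq_sum_range]
  exact sum_mem fun i _ ↦ W.smul_mem _ (hpow i)

end Span

/-! ### Heights of the roots of a fixed polynomial. -/

section Height

open NumberField Height Polynomial

lemma one_le_absoluteHeight {K : Type*} [Field K] [NumberField K] (x : K) :
    1 ≤ absoluteHeight x :=
  Real.one_le_rpow (one_le_mulHeight₁ x) (by positivity)

lemma absoluteHeight_mul_le {K : Type*} [Field K] [NumberField K] (x y : K) :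
    absoluteHeight (x * y) ≤ absoluteHeight x * absoluteHeight y := by
  rw [absoluteHeight, absoluteHeight, absoluteHeight,
    ← Real.mul_rpow (mulHeight₁_nonneg x) (mulHeight₁_nonneg y)]
  exact Real.rpow_le_rpow (mulHeight₁_nonneg _) (mulHeight₁_mul_le x y) (by positivity)

lemma absoluteHeight_inv {K : Type*} [Field K] [NumberField K] (x : K) :
    absoluteHeight x⁻¹ = absoluteHeight x := by
  rw [absoluteHeight, absoluteHeight, mulHeight₁_inv]

lemma absoluteHeight_le_of_isIntegral {K : Type*} [Field K] [NumberField K] {x : K}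
    (hx : IsIntegral ℤ x) {B : ℝ} (hB : 1 ≤ B) (h : ∀ w : InfinitePlace K, w x ≤ B) :
    absoluteHeight x ≤ B := by
  have hfin : ∏ᶠ v : FinitePlace K, max (v x) 1 = 1 := by
    refine finprod_eq_one_of_forall_eq_one fun v ↦ max_eq_right ?_
    rw [← FinitePlace.norm_embedding_eq]
    exact FinitePlace.norm_le_one K v.maximalIdeal (⟨x, hx⟩ : 𝓞 K)
  have hn0 : Module.finrank ℚ K ≠ 0 := Module.finrank_pos.ne'
  have hle : mulHeight₁ x ≤ B ^ Module.finrank ℚ K := by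
    rw [NumberField.mulHeight₁_eq, hfin, mul_one, ← InfinitePlace.sum_mult_eq,
      ← Finset.prod_pow_eq_pow_sum]
    exact Finset.prod_le_prod (fun _ _ ↦ by positivity) fun w _ ↦
      pow_le_pow_left₀ (by positivity) (max_le (h w) hB) _
  refine (Real.rpow_le_rpow (mulHeight₁_nonneg x) hle (by positivity)).trans_eq ?_
  rw [Real.pow_rpow_inv_natCast (by linarith) hn0]

lemma map_C_map_eval₂RingHom {R S : Type*} [CommRing R] [CommRing S] (σ : R →+* S) (z : S)
    (q : R[X]) : (q.map C).map (eval₂RingHom σ z) = q.map σ := by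
  rw [map_map]
  congr 1
  ext
  simp

/-- The roots of a fixed polynomial have bounded height. -/
lemma exists_absoluteHeight_le_of_aeval_eq_zero {k : Type*} [Field k] [NumberField k] {p : k[X]}
    (hp : p ≠ 0) : ∃ B : ℝ, 1 ≤ B ∧ ∀ (K : Type*) [Field K] [NumberField K] [Algebra k K] (α : K),
      aeval α p = 0 → absoluteHeight α ≤ B := by
  set q := p * C p.leadingCoeff⁻¹ with hq
  have hqm : q.Monic := monic_mul_leadingCoeff_inv hp
  -- As a polynomial constant in T, q has weight 0, so the earlier size and denominator bounds apply
  -- without involving a specialization point.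
  set G : k[X][X] := q.map C with hGdef
  have hG : IsWeighted 0 G := by
    refine ⟨hqm.map _, fun j ↦ ?_⟩
    rw [hGdef, coeff_map, natDegree_C]
    exact Nat.zero_le _
  obtain ⟨B, hB1, hB⟩ := hG.exists_norm_root_le
  obtain ⟨D, hD0, hD⟩ := IsWeighted.exists_natCast_mul_isIntegral G
  have hD1 : (1 : ℝ) ≤ D := by exact_mod_cast Nat.one_le_iff_ne_zero.mpr hD0
  refine ⟨D * B * D, one_le_mul_of_one_le_of_one_le (one_le_mul_of_one_le_of_one_le hD1 hB1) hD1,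
    fun K _ _ _ α hα ↦ ?_⟩
  have hα' : aeval α q = 0 := by rw [hq, map_mul, hα, zero_mul]
  have hint : IsIntegral ℤ ((D : K) * α) := by
    have := hG.isIntegral_mul_root hD (K := K) (L := K) (b := 1) (α := 0) (β := α) isIntegral_one
      (by simpa using isIntegral_zero) (by
        rw [hGdef, map_C_map_eval₂RingHom, aeval_map_algebraMap]
        exact hα')
    simpa using this
  have hDα (w : InfinitePlace K) : w ((D : K) * α) ≤ D * B := by
    rw [map_mul, ← InfinitePlace.norm_embedding_eq, ← InfinitePlace.norm_embedding_eq w α,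
      map_natCast, Complex.norm_natCast]
    refine mul_le_mul_of_nonneg_left ?_ (Nat.cast_nonneg _)
    have := hB (w.embedding.comp (algebraMap k K)) 0 (w.embedding α) (by
      rw [hGdef, map_C_map_eval₂RingHom, ← map_map, eval_map_apply, eval_map_algebraMap, hα', map_zero])
    simpa using this
  have hDw (w : InfinitePlace K) : w (D : K) ≤ D := by
    rw [← InfinitePlace.norm_embedding_eq, map_natCast, Complex.norm_natCast]
  have hDK : (D : K) ≠ 0 := by exact_mod_cast hD0
  calc absoluteHeight α = absoluteHeight ((D : K) * α * (D : K)⁻¹) := by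
        rw [mul_comm (D : K), mul_inv_cancel_right₀ hDK]
    _ ≤ absoluteHeight ((D : K) * α) * absoluteHeight (D : K) := by
        rw [← absoluteHeight_inv (D : K)]
        exact absoluteHeight_mul_le _ _
    _ ≤ D * B * D := by
        refine mul_le_mul
          (absoluteHeight_le_of_isIntegral hint (one_le_mul_of_one_le_of_one_le hD1 hB1) hDα)
          (absoluteHeight_le_of_isIntegral (isIntegral_natCast D) hD1 hDw)
          (zero_le_one.trans (one_le_absoluteHeight _)) (by positivity)

end Height

/-! ### A basis of total weight m(d-1). -/

section Basis

open Polynomial IntermediateField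

variable {k E : Type*} [Field k] [Field E] [Algebra k E]

/-- The set {1} is extended to a basis inside the pole-bounded functions; 1 gets weight 0 and the
other d - 1 elements get weight m. -/
lemma exists_basis_poleBounded {t : E} [FiniteDimensional k⟮t⟯ E] {d : ℕ}
    (hd : Module.finrank k⟮t⟯ E = d) {m : ℕ}
    (h : Submodule.span k⟮t⟯ {w | PoleBounded k t m w} = ⊤) :
    ∃ (b : Module.Basis (Fin d) k⟮t⟯ E) (a : Fin d → ℕ), (∀ i, PoleBounded k t (a i) (b i)) ∧
      ∑ i, a i = m * (d - 1) := by
  classical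
  obtain ⟨s, hs, h1s, hspan, hli⟩ := exists_linearIndepOn_id_extension (K := k⟮t⟯)
    (s := {(1 : E)}) (t := {w | PoleBounded k t m w})
    ((linearIndepOn_singleton_iff k⟮t⟯).mpr one_ne_zero)
    (by rintro _ rfl; exact PoleBounded.one t m)
  have htop : ⊤ ≤ Submodule.span k⟮t⟯ (Set.range ((↑) : s → E)) := by
    rw [Subtype.range_coe, ← h, Submodule.span_le]
    exact hspan
  let b₀ : Module.Basis s k⟮t⟯ E := .mk hli htop
  have : Fintype s := FiniteDimensional.fintypeBasisIndex b₀
  let ε : s ≃ Fin d :=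
    Fintype.equivFinOfCardEq ((Module.finrank_eq_card_basis b₀).symm.trans hd)
  let i₁ : s := ⟨1, h1s rfl⟩
  have hb (i : s) : b₀ i = i := Module.Basis.mk_apply _ _ _
  refine ⟨b₀.reindex ε, fun i ↦ if i = ε i₁ then 0 else m, fun i ↦ ?_, ?_⟩
  · rw [Module.Basis.reindex_apply, hb]
    change PoleBounded k t (if i = ε i₁ then 0 else m) _
    split_ifs with hi
    · rw [hi, Equiv.symm_apply_apply]
      exact PoleBounded.one t 0
    · exact hs (ε.symm i).2
  · rw [Finset.sum_ite, Finset.sum_const_zero, zero_add, Finset.sum_const, smul_eq_mul, mul_comm,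
      Finset.filter_ne', Finset.card_erase_of_mem (Finset.mem_univ _), Finset.card_univ,
      Fintype.card_fin]

end Basis

/-! ### The discriminant bound for specializations of the integral closure of k[t]. -/

section Specialization

open Polynomial IntermediateField

open scoped IntermediateField.algebraAdjoinAdjoin

variable {k E : Type*} [Field k] [Field E] [Algebra k E]

/-- The function `t` as an element of the integral closure of `k[t]`. -/
def integralClosureGen (k : Type*) {E : Type*} [Field k] [Field E] [Algebra k E] (t : E) :
    integralClosure (Algebra.adjoin k {t}) E :=
  algebraMap (Algebra.adjoin k {t}) _ ⟨t, Algebra.self_mem_adjoin_singleton k t⟩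

lemma aeval_map_eval₂RingHom_of_algHom {t : E} {K L : Type*} [Field K] [Field L] [Algebra k K]
    [Algebra k L] [Algebra K L] [IsScalarTower k K L] {α : K}
    (ψ : integralClosure (Algebra.adjoin k {t}) E →ₐ[k] L)
    (hψ : ψ (integralClosureGen k t) = algebraMap K L α) {G : k[X][X]}
    {w : integralClosure (Algebra.adjoin k {t}) E}
    (h : aeval (w : E) (G.map (eval₂RingHom (algebraMap k E) t)) = 0) :
    aeval (ψ w) (G.map (eval₂RingHom (algebraMap k K) α)) = 0 := by
  have key : G.eval₂ (aeval (integralClosureGen k t)).toRingHom w = 0 := by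
    apply Subtype.val_injective
    change algebraMap (integralClosure (Algebra.adjoin k {t}) E) E _ = 0
    rw [hom_eval₂, ← h, aeval_def, eval₂_map]
    congr 1
    ext
    · simp
    · simp; rfl
  have := congrArg ψ.toRingHom key
  rw [map_zero, hom_eval₂] at this
  rw [aeval_def, eval₂_map, ← this]
  congr 1
  ext
  · simp [← IsScalarTower.algebraMap_apply]
  · simpa using hψ.symm

lemma exists_eq_algebraMap_aeval {t : E} {K L : Type*} [Field K] [Field L] [Algebra k K]
    [Algebra k L] [Algebra K L] [IsScalarTower k K L] {α : K}
    (ψ : integralClosure (Algebra.adjoin k {t}) E →ₐ[k] L)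
    (hψ : ψ (integralClosureGen k t) = algebraMap K L α) (c : Algebra.adjoin k {t}) :
    ∃ p : k[X], aeval t p = (c : E) ∧
      ψ (algebraMap _ _ c) = algebraMap K L (aeval α p) := by
  obtain ⟨c, hc⟩ := c
  rw [Algebra.adjoin_singleton_eq_range_aeval] at hc
  obtain ⟨p, rfl⟩ := hc
  refine ⟨p, rfl, ?_⟩
  rw [← aeval_algebraMap_apply, ← hψ, aeval_algHom_apply]
  congr 1
  apply Subtype.val_injective
  change _ = algebraMap (integralClosure (Algebra.adjoin k {t}) E) E _
  rw [← aeval_algebraMap_apply]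
  rfl

/-- Coefficients in k[t] specialize to elements of K, so generators over k[t] specialize to
generators over K. -/
lemma mem_span_image_of_mem_span {t : E} {K L : Type*} [Field K] [Field L] [Algebra k K]
    [Algebra k L] [Algebra K L] [IsScalarTower k K L] {α : K}
    (ψ : integralClosure (Algebra.adjoin k {t}) E →ₐ[k] L)
    (hψ : ψ (integralClosureGen k t) = algebraMap K L α)
    {s : Set (integralClosure (Algebra.adjoin k {t}) E)}
    {w : integralClosure (Algebra.adjoin k {t}) E}
    (hw : w ∈ Submodule.span (Algebra.adjoin k {t}) s) :
    ψ w ∈ Submodule.span K (ψ '' s) := by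
  induction hw using Submodule.span_induction with
  | mem x hx => exact Submodule.subset_span ⟨x, hx, rfl⟩
  | zero => rw [map_zero]; exact zero_mem _
  | add x y _ _ hx hy => rw [map_add]; exact add_mem hx hy
  | smul c x _ hx =>
    obtain ⟨p, -, hp⟩ := exists_eq_algebraMap_aeval ψ hψ c
    rw [Algebra.smul_def, map_mul, hp, ← Algebra.smul_def]
    exact Submodule.smul_mem _ _ hx

lemma finite_integralClosure_adjoin [CharZero k] {t : E} (ht : Transcendental k t)
    [FiniteDimensional k⟮t⟯ E] :
    Module.Finite (Algebra.adjoin k {t}) (integralClosure (Algebra.adjoin k {t}) E) := by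
  have := isIntegrallyClosed_adjoin_of_transcendental ht
  have : IsNoetherianRing (Algebra.adjoin k {t}) :=
    isNoetherianRing_of_ringEquiv k[X] (Polynomial.algEquivOfTranscendental k t ht).toRingEquiv
  have := IsIntegralClosure.isNoetherian (Algebra.adjoin k {t}) k⟮t⟯ E
    (integralClosure (Algebra.adjoin k {t}) E)
  infer_instance

/-- The bound for the discriminants of the residue fields, for the specializations
`ψ` of the functions integral over `k[t]`. -/
theorem exists_normalizedDiscriminant_le_of_span [NumberField k] {t : E} (ht : Transcendental k t)
    [FiniteDimensional k⟮t⟯ E] {d : ℕ} (hd : Module.finrank k⟮t⟯ E = d) {m : ℕ}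
    (h : Submodule.span k⟮t⟯ {w | PoleBounded k t m w} = ⊤) :
    ∃ c : ℝ, 0 < c ∧ ∀ (K : Type*) [Field K] [NumberField K] [Algebra k K] (L : Type*) [Field L]
      [Algebra k L] [Algebra K L] [IsScalarTower k K L] (α : K)
      (ψ : integralClosure (Algebra.adjoin k {t}) E →ₐ[k] L),
      ψ (integralClosureGen k t) = algebraMap K L α → Submodule.span K (Set.range ψ) = ⊤ →
      Module.finrank K L = d →
      normalizedDiscriminant K L ≤ c * absoluteHeight α ^ (2 * (m * (d - 1))) := by
  classical
  set A := integralClosure (Algebra.adjoin k {t}) E with hA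
  obtain ⟨b, a, hba, hsum⟩ := exists_basis_poleBounded hd h
  choose G hG hGb using fun i ↦ (hba i).exists_isWeighted ht
  obtain ⟨c₁, hc₁, H₁⟩ := IsWeighted.exists_normalizedDiscriminant_le hG
  let w : Fin d → A := fun i ↦ ⟨b i, (hba i).1⟩
  have := finite_integralClosure_adjoin ht
  -- The finite generating set Y is the reserve for the α at which the basis w degenerates.
  obtain ⟨Y, hY⟩ := Module.Finite.fg_top (R := Algebra.adjoin k {t}) (M := A)
  choose a' G' hG' hGb' using fun y : A ↦ exists_isWeighted_of_isIntegral ht y.2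
  have hδ (y : A) : ∃ δ : nonZeroDivisors (Algebra.adjoin k {t}),
      (δ : Algebra.adjoin k {t}) • y ∈ Submodule.span (Algebra.adjoin k {t}) (Set.range w) := by
    obtain ⟨δ, hδ⟩ := multiple_mem_span_of_mem_localization_span
      (nonZeroDivisors (Algebra.adjoin k {t})) k⟮t⟯ (Set.range b) (y : E)
      (by rw [b.span_eq]; trivial)
    refine ⟨δ, ?_⟩
    have hrange : Set.range b = A.val.toLinearMap '' Set.range w := by
      rw [← Set.range_comp]; rfl
    rw [hrange, Submodule.span_image] at hδ
    obtain ⟨z, hz, hzy⟩ := hδ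
    have : z = (δ : Algebra.adjoin k {t}) • y := Subtype.val_injective hzy
    rwa [← this]
  choose δ hδ using hδ
  -- D is a common denominator: D times the integral closure lies in the k[t]-span of w. Only the
  -- roots of p, where p(t) = D, can be exceptional.
  set D : nonZeroDivisors (Algebra.adjoin k {t}) := ∏ y ∈ Y, δ y with hD
  have hDY (y : A) : (D : Algebra.adjoin k {t}) • y ∈
      Submodule.span (Algebra.adjoin k {t}) (Set.range w) := by
    have hy : y ∈ Submodule.span (Algebra.adjoin k {t}) (Y : Set A) := by rw [hY]; trivial
    induction hy using Submodule.span_induction with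
    | zero => rw [smul_zero]; exact zero_mem _
    | add x y _ _ hx hy => rw [smul_add]; exact add_mem hx hy
    | smul c x _ hx => rw [smul_comm]; exact Submodule.smul_mem _ _ hx
    | mem y hy =>
      rw [hD, ← Finset.prod_erase_mul _ _ hy, Submonoid.coe_mul, mul_smul]
      exact Submodule.smul_mem _ _ (hδ y)
  obtain ⟨p, hp⟩ : ∃ p : k[X], aeval t p = ((D : Algebra.adjoin k {t}) : E) := by
    exact (Algebra.adjoin_singleton_eq_range_aeval k t).le (D : Algebra.adjoin k {t}).2
  have hp0 : p ≠ 0 := by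
    rintro rfl
    rw [map_zero] at hp
    exact nonZeroDivisors.ne_zero D.2 (Subtype.val_injective hp.symm)
  obtain ⟨B, hB1, hB⟩ := exists_absoluteHeight_le_of_aeval_eq_zero hp0
  choose c₂ hc₂ H₂ using fun f : Fin d → Y ↦
    IsWeighted.exists_normalizedDiscriminant_le fun i ↦ hG' (f i)
  have hBpos : 0 < B := by linarith
  have hpos (f : Fin d → Y) : 0 < c₂ f * B ^ (2 * ∑ i, a' (f i)) :=
    mul_pos (hc₂ f) (pow_pos hBpos _)
  -- The sum covers every choice of d elements of Y, whichever of them yields a basis at an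
  -- exceptional α.
  refine ⟨c₁ + ∑ f : Fin d → Y, c₂ f * B ^ (2 * ∑ i, a' (f i)),
    add_pos_of_pos_of_nonneg hc₁ (Finset.sum_nonneg fun f _ ↦ (hpos f).le), ?_⟩
  intro K _ _ _ L _ _ _ _ α ψ hψ hspan hfin
  have hH := one_le_absoluteHeight α
  -- At a root of p the height is at most B, so the uncontrolled weights of the elements of Y only
  -- affect the constant.
  by_cases hα : aeval α p = 0
  · have hYspan : Submodule.span K (ψ '' (Y : Set A)) = ⊤ := by
      rw [eq_top_iff, ← hspan, Submodule.span_le]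
      rintro _ ⟨z, rfl⟩
      exact mem_span_image_of_mem_span ψ hψ (by rw [hY]; trivial)
    have : Module.Finite K L := ⟨⟨Y.image ψ, by rw [Finset.coe_image, hYspan]⟩⟩
    obtain ⟨f, hf, hfspan, -⟩ := Submodule.exists_fun_fin_finrank_span_eq K (ψ '' (Y : Set A))
    have hcard : d = Module.finrank K (Submodule.span K (ψ '' (Y : Set A))) := by
      rw [hYspan, finrank_top, hfin]
    choose g hgY hg using fun i : Fin d ↦ hf (Fin.cast hcard i)
    have hgspan : ⊤ ≤ Submodule.span K (Set.range fun i ↦ ψ (g i)) := by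
      rw [← hYspan, ← hfspan, Submodule.span_le]
      rintro _ ⟨i, rfl⟩
      exact Submodule.subset_span ⟨Fin.cast hcard.symm i, hg _⟩
    have hb := H₂ (fun i ↦ ⟨g i, hgY i⟩) K L
      (basisOfTopLeSpanOfCardEqFinrank _ hgspan (by rw [Fintype.card_fin, hfin])) α fun i ↦ by
        rw [coe_basisOfTopLeSpanOfCardEqFinrank]
        exact aeval_map_eval₂RingHom_of_algHom ψ hψ (hGb' (g i))
    set f' : Fin d → Y := fun i ↦ ⟨g i, hgY i⟩
    calc normalizedDiscriminant K L ≤ c₂ f' * absoluteHeight α ^ (2 * ∑ i, a' (f' i)) := hb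
      _ ≤ c₂ f' * B ^ (2 * ∑ i, a' (f' i)) :=
          mul_le_mul_of_nonneg_left (pow_le_pow_left₀ (by linarith) (hB K α hα) _) (hc₂ f').le
      _ ≤ ∑ f : Fin d → Y, c₂ f * B ^ (2 * ∑ i, a' (f i)) :=
          Finset.single_le_sum (fun f _ ↦ (hpos f).le) (Finset.mem_univ f')
      _ ≤ c₁ + ∑ f : Fin d → Y, c₂ f * B ^ (2 * ∑ i, a' (f i)) := by linarith
      _ ≤ _ := le_mul_of_one_le_right
          (add_nonneg hc₁.le (Finset.sum_nonneg fun f _ ↦ (hpos f).le)) (one_le_pow₀ hH)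
  · have hDψ : ψ (algebraMap _ _ (D : Algebra.adjoin k {t})) = algebraMap K L (aeval α p) := by
      obtain ⟨q, hq, hqψ⟩ := exists_eq_algebraMap_aeval ψ hψ D
      rw [← hp] at hq
      have : q = p := transcendental_iff_injective.mp ht hq
      rw [hqψ, this]
    -- Since p(α) ≠ 0, D specializes to a unit, so the d values of w span L and hence form a basis.
    have hwspan : ⊤ ≤ Submodule.span K (Set.range (ψ ∘ w)) := by
      rw [← hspan, Submodule.span_le]
      rintro _ ⟨z, rfl⟩
      have := mem_span_image_of_mem_span ψ hψ (hDY z)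
      rw [Algebra.smul_def, map_mul, hDψ, ← Algebra.smul_def, ← Set.range_comp] at this
      exact (Submodule.smul_mem_iff _ hα).mp this
    have hb := H₁ K L (basisOfTopLeSpanOfCardEqFinrank _ hwspan (by rw [Fintype.card_fin, hfin])) α fun i ↦ by
      rw [coe_basisOfTopLeSpanOfCardEqFinrank]
      exact aeval_map_eval₂RingHom_of_algHom ψ hψ (hGb i)
    rw [hsum] at hb
    refine hb.trans (mul_le_mul_of_nonneg_right ?_ (by positivity))
    linarith [Finset.sum_nonneg fun (f : Fin d → Y) (_ : f ∈ Finset.univ) ↦ (hpos f).le]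

end Specialization

/-! ### Specialization at a point of the curve. -/

section Specialization

open Polynomial IntermediateField

open scoped IntermediateField.algebraAdjoinAdjoin

lemma RingHom.exists_lift_of_injective {A O B : Type*} [CommRing A] [CommRing O] [CommRing B]
    {j : O →+* B} (hj : Function.Injective j) (f : A →+* B) (h : ∀ a, f a ∈ j.range) :
    ∃ g : A →+* O, ∀ a, j (g a) = f a := by
  let e : O ≃+* j.range := RingEquiv.ofBijective j.rangeRestrict
    ⟨fun x y hxy ↦ hj (congrArg Subtype.val hxy), j.rangeRestrict_surjective⟩
  refine ⟨e.symm.toRingHom.comp (f.codRestrict j.range h), fun a ↦ ?_⟩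
  exact congrArg Subtype.val (e.apply_symm_apply (f.codRestrict j.range h a))

/-- In a Dedekind domain, of two elements one divides the other up to denominators outside
a given nonzero prime. -/
lemma IsDedekindDomain.exists_mul_eq_mul {R : Type*} [CommRing R] [IsDedekindDomain R]
    {p : Ideal R} [p.IsPrime] (hp : p ≠ ⊥) (x y : R) :
    ∃ a s, s ∉ p ∧ (x * a = y * s ∨ y * a = x * s) := by
  have := IsLocalization.AtPrime.isDiscreteValuationRing_of_dedekind_domain R hp
    (Localization.AtPrime p)
  have hinj : Function.Injective (algebraMap R (Localization.AtPrime p)) :=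
    IsLocalization.injective _ p.primeCompl_le_nonZeroDivisors
  have key (x y : R) (c : Localization.AtPrime p)
      (h : algebraMap R _ x * c = algebraMap R (Localization.AtPrime p) y) :
      ∃ a s, s ∉ p ∧ x * a = y * s := by
    obtain ⟨⟨a, s⟩, hs⟩ := IsLocalization.surj p.primeCompl c
    refine ⟨a, s, s.2, hinj ?_⟩
    rw [map_mul, map_mul, ← hs, ← h, mul_assoc]
  obtain ⟨c, h | h⟩ := ValuationRing.cond (algebraMap R (Localization.AtPrime p) x)
    (algebraMap R (Localization.AtPrime p) y)
  · obtain ⟨a, s, hs, h⟩ := key x y c h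
    exact ⟨a, s, hs, .inl h⟩
  · obtain ⟨a, s, hs, h⟩ := key y x c h
    exact ⟨a, s, hs, .inr h⟩

section LocalRing

variable {K E O Ω : Type*} [Field K] [Field E] [Algebra K E] [CommRing O]
  [IsIntegrallyClosed O] [Algebra O E] [IsFractionRing O E] [Algebra K O] [IsScalarTower K O E]
  {t : E} {τ : O}

/-- A normal local ring containing K[t] contains everything integral over K[t]: such functions are
regular wherever t is. -/
lemma exists_algebraMap_eq_of_isIntegral_adjoin (hτ : algebraMap O E τ = t) {w : E}
    (hw : IsIntegral (Algebra.adjoin K {t}) w) : ∃ o : O, algebraMap O E o = w := by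
  refine IsIntegrallyClosed.isIntegral_iff.mp (IsIntegral.trans_of_forall (fun s ↦ ?_) hw)
  obtain ⟨s, hs⟩ := s
  rw [Algebra.adjoin_singleton_eq_range_aeval] at hs
  obtain ⟨p, rfl⟩ := hs
  change IsIntegral O (aeval t p)
  rw [← hτ, aeval_algebraMap_apply]
  exact isIntegral_algebraMap

/-- The values of the functions in an integrally closed local ring are already taken by
the functions which are integral over `K[t]`. -/
lemma exists_isIntegral_adjoin_and_eq [CharZero K] (ht : Transcendental K t)
    [FiniteDimensional K⟮t⟯ E] [IsDomain O] (hτ : algebraMap O E τ = t) [Field Ω] [Algebra K Ω]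
    [Algebra.IsAlgebraic K Ω] (ev : O →ₐ[K] Ω) {α : K} (hα : ev τ = algebraMap K Ω α) (o : O) :
    ∃ r : O, IsIntegral (Algebra.adjoin K {t}) (algebraMap O E r) ∧ ev r = ev o := by
  have hinj : Function.Injective (algebraMap O E) := IsFractionRing.injective O E
  have : IsPrincipalIdealRing (Algebra.adjoin K {t}) :=
    .of_surjective (Polynomial.algEquivOfTranscendental K t ht).toRingEquiv.toRingHom
      (Polynomial.algEquivOfTranscendental K t ht).surjective
  have := integralClosure.isDedekindDomain (Algebra.adjoin K {t}) K⟮t⟯ E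
  have := integralClosure.isFractionRing_of_finite_extension (A := Algebra.adjoin K {t}) K⟮t⟯ E
  set R := integralClosure (Algebra.adjoin K {t}) E with hR
  obtain ⟨ρ, hρ⟩ := RingHom.exists_lift_of_injective hinj (algebraMap R E) fun r ↦
    exists_algebraMap_eq_of_isIntegral_adjoin hτ r.2
  have hρint (r : R) : IsIntegral (Algebra.adjoin K {t}) (algebraMap O E (ρ r)) := by
    rw [hρ]; exact r.2
  set 𝔭 : Ideal R := RingHom.ker (ev.toRingHom.comp ρ) with h𝔭
  have h𝔭mem (r : R) : r ∈ 𝔭 ↔ ev (ρ r) = 0 := Iff.rfl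
  have : 𝔭.IsPrime := RingHom.ker_isPrime _
  -- The prime of functions vanishing at the point contains t - α, which is nonzero because t is
  -- transcendental.
  have hne : 𝔭 ≠ ⊥ := by
    intro hbot
    let z : R := algebraMap (Algebra.adjoin K {t}) R
      (⟨t, Algebra.self_mem_adjoin_singleton K t⟩ - algebraMap K _ α)
    have hz : algebraMap R E z = t - algebraMap K E α := rfl
    have hρz : ρ z = τ - algebraMap K O α := by
      apply hinj
      rw [hρ, hz, map_sub, hτ, ← IsScalarTower.algebraMap_apply]
    have hz𝔭 : z ∈ 𝔭 := by
      rw [h𝔭mem, hρz, map_sub, hα, AlgHom.commutes, sub_self]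
    rw [hbot, Ideal.mem_bot] at hz𝔭
    rw [hz𝔭, map_zero] at hz
    exact ht (sub_eq_zero.mp hz.symm ▸ isAlgebraic_algebraMap α)
  -- The values of R form a K-algebra, closed under inverses because Ω is algebraic over K. It is
  -- therefore enough to write each value of O as a quotient of values of R.
  let S : Subalgebra K Ω :=
    { (ev.toRingHom.comp ρ).range with
      algebraMap_mem' := fun a ↦ ⟨algebraMap K R a, by
        have : ρ (algebraMap K R a) = algebraMap K O a := by
          apply hinj
          rw [hρ, ← IsScalarTower.algebraMap_apply, ← IsScalarTower.algebraMap_apply]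
        change ev (ρ (algebraMap K R a)) = _
        rw [this, AlgHom.commutes]⟩ }
  have hS (r : R) : ev (ρ r) ∈ S := ⟨r, rfl⟩
  have hSinv {z : Ω} (hz : z ∈ S) : z⁻¹ ∈ S :=
    S.inv_mem_of_algebraic (x := ⟨z, hz⟩) (Algebra.IsAlgebraic.isAlgebraic z)
  suffices h : ev o ∈ S by
    obtain ⟨r, hr⟩ := h
    exact ⟨ρ r, hρint r, hr⟩
  obtain ⟨x, y, hy, hxy⟩ := IsFractionRing.div_surjective (A := R) (algebraMap O E o)
  have hy0 : ρ y ≠ 0 := by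
    intro h0
    have := hρ y
    rw [h0, map_zero] at this
    exact nonZeroDivisors.ne_zero hy
      (IsFractionRing.injective R E (by rw [← this, map_zero]))
  have hyE : algebraMap R E y ≠ 0 := by
    rw [← hρ]; exact (map_ne_zero_iff _ hinj).mpr hy0
  have hox : o * ρ y = ρ x := by
    apply hinj
    rw [map_mul, hρ, hρ, ← hxy, div_mul_cancel₀ _ hyE]
  -- Since the localization of R at 𝔭 is a valuation ring, o equals s/a or a/s with s not vanishing
  -- at the point; in the first case a cannot vanish either, since o is regular there.
  obtain ⟨a, s, hs, h | h⟩ := IsDedekindDomain.exists_mul_eq_mul hne x y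
  · have h1 : o * ρ a = ρ s := by
      apply mul_left_cancel₀ hy0
      rw [← map_mul ρ y s, ← h, map_mul, ← hox]
      ring
    have h2 : ev o * ev (ρ a) = ev (ρ s) := by rw [← map_mul, h1]
    rw [h𝔭mem] at hs
    have ha : ev (ρ a) ≠ 0 := by
      intro h0
      rw [h0, mul_zero] at h2
      exact hs h2.symm
    rw [eq_div_of_mul_eq ha h2, div_eq_mul_inv]
    exact mul_mem (hS s) (hSinv (hS a))
  · have h1 : o * ρ s = ρ a := by
      apply mul_left_cancel₀ hy0
      rw [← map_mul ρ y a, h, map_mul, ← hox]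
      ring
    have h2 : ev o * ev (ρ s) = ev (ρ a) := by rw [← map_mul, h1]
    rw [eq_div_of_mul_eq hs h2, div_eq_mul_inv]
    exact mul_mem (hS a) (hSinv (hS s))

end LocalRing

section ScalarExtension

variable {k K E E' ι : Type*} [Field k] [Field K] [Field E] [Field E'] [Algebra k K] [Algebra k E]
  [Algebra K E'] [Algebra E E'] [Algebra k E'] [IsScalarTower k K E'] [IsScalarTower k E E']

lemma Transcendental.algebraMap_of_isAlgebraic [Algebra.IsAlgebraic k K] {t : E}
    (ht : Transcendental k t) : Transcendental K (algebraMap E E' t) := fun h ↦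
  ht ((isAlgebraic_algebraMap_iff (algebraMap E E').injective).mp (h.restrictScalars k))

variable (K E') in
lemma finiteDimensional_adjoin_algebraMap [Module.Finite E E'] (t : E)
    [FiniteDimensional k⟮t⟯ E] : FiniteDimensional K⟮algebraMap E E' t⟯ E' := by
  have : FiniteDimensional k⟮t⟯ E' := .trans k⟮t⟯ E E'
  have hmem (z : k⟮t⟯) : algebraMap E E' z ∈ K⟮algebraMap E E' t⟯ := by
    have : k⟮t⟯ ≤ (IntermediateField.restrictScalars k K⟮algebraMap E E' t⟯).comap
        (IsScalarTower.toAlgHom k E E') := by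
      rw [adjoin_simple_le_iff]
      exact mem_adjoin_simple_self K (algebraMap E E' t)
    exact this z.2
  obtain ⟨s, hs⟩ := Module.Finite.fg_top (R := k⟮t⟯) (M := E')
  refine ⟨⟨s, ?_⟩⟩
  rw [eq_top_iff]
  rintro w -
  have hw : w ∈ Submodule.span k⟮t⟯ (s : Set E') := by rw [hs]; trivial
  induction hw using Submodule.span_induction with
  | mem x hx => exact Submodule.subset_span hx
  | zero => exact zero_mem _
  | add x y _ _ hx hy => exact add_mem hx hy
  | smul c x _ hx =>
    have : c • x = (⟨_, hmem c⟩ : K⟮algebraMap E E' t⟯) • x := by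
      rw [Algebra.smul_def, Algebra.smul_def]; rfl
    rw [this]
    exact Submodule.smul_mem _ _ hx

variable [Fintype ι] {e : Module.Basis ι k K} {b : Module.Basis ι E E'}

lemma isIntegral_adjoin_algebraMap {t w : E} (hw : IsIntegral (Algebra.adjoin k {t}) w) :
    IsIntegral (Algebra.adjoin K {algebraMap E E' t}) (algebraMap E E' w) := by
  refine IsIntegral.trans_of_forall (fun s ↦ ?_) 
    (hw.map (IsScalarTower.toAlgHom (Algebra.adjoin k {t}) E E'))
  obtain ⟨s, hs⟩ := s
  rw [Algebra.adjoin_singleton_eq_range_aeval] at hs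
  obtain ⟨p, rfl⟩ := hs
  change IsIntegral _ (algebraMap E E' (aeval t p))
  rw [← aeval_algebraMap_apply, ← aeval_map_algebraMap K]
  have hmem : aeval (algebraMap E E' t) (p.map (algebraMap k K)) ∈
      Algebra.adjoin K {algebraMap E E' t} := by
    rw [Algebra.adjoin_singleton_eq_range_aeval]
    exact ⟨_, rfl⟩
  exact isIntegral_algebraMap (A := E') (x := (⟨_, hmem⟩ : Algebra.adjoin K {algebraMap E E' t}))

/-- Specialization of the functions which are integral over `k[t]` at a point of
the extended curve; its values span the field generated by the values of all regular functions. -/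
theorem exists_specialization [CharZero k] (hb : ∀ i, b i = algebraMap K E' (e i)) {t : E}
    (ht : Transcendental k t) [FiniteDimensional k⟮t⟯ E] {O Ω : Type*} [CommRing O] [IsDomain O]
    [IsIntegrallyClosed O] [Algebra O E'] [IsFractionRing O E'] [Algebra K O]
    [IsScalarTower K O E'] [Field Ω] [Algebra K Ω] [Algebra k Ω] [IsScalarTower k K Ω]
    [Algebra.IsAlgebraic K Ω] (ev : O →ₐ[K] Ω) {τ : O}
    (hτ : algebraMap O E' τ = algebraMap E E' t) {α : K} (hα : ev τ = algebraMap K Ω α) :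
    ∃ ψ : integralClosure (Algebra.adjoin k {t}) E →ₐ[k] IntermediateField.adjoin K (Set.range ev),
      ψ (integralClosureGen k t) = algebraMap K _ α ∧ Submodule.span K (Set.range ψ) = ⊤ := by
  have : Module.Finite k K := .of_basis e
  have : Module.Finite E E' := .of_basis b
  have : CharZero K := charZero_of_injective_algebraMap (algebraMap k K).injective
  have := finiteDimensional_adjoin_algebraMap (k := k) K E' t
  have ht' : Transcendental K (algebraMap E E' t) := ht.algebraMap_of_isAlgebraic
  have hinj : Function.Injective (algebraMap O E') := IsFractionRing.injective O E'
  set A := integralClosure (Algebra.adjoin k {t}) E with hA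
  obtain ⟨g, hg⟩ := RingHom.exists_lift_of_injective hinj
    ((algebraMap E E').comp (algebraMap A E)) fun w ↦
      exists_algebraMap_eq_of_isIntegral_adjoin (K := K) hτ (isIntegral_adjoin_algebraMap w.2)
  let F := IntermediateField.adjoin K (Set.range ev)
  have hF (o : O) : ev o ∈ F := IntermediateField.subset_adjoin K _ ⟨o, rfl⟩
  let ψ : A →ₐ[k] F :=
    { (ev.toRingHom.comp g).codRestrict F.toSubring fun w ↦ hF (g w) with
      commutes' := fun a ↦ by
        have : g (algebraMap k A a) = algebraMap K O (algebraMap k K a) := by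
          apply hinj
          rw [hg, ← IsScalarTower.algebraMap_apply K O E', ← IsScalarTower.algebraMap_apply k K E',
            IsScalarTower.algebraMap_apply k E E']
          rfl
        apply Subtype.val_injective
        change ev (g (algebraMap k A a)) = algebraMap k Ω a
        rw [this, AlgHom.commutes, ← IsScalarTower.algebraMap_apply] }
  have hψ (w : A) : (ψ w : Ω) = ev (g w) := rfl
  refine ⟨ψ, ?_, ?_⟩
  · apply Subtype.val_injective
    have : g (integralClosureGen k t) = τ := by
      apply hinj
      rw [hg, hτ]
      rfl
    rw [hψ, this, hα]
    rfl
  · rw [eq_top_iff]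
    rintro ⟨z, hz⟩ -
    have hz' : z ∈ ev.range := by
      have h1 : z ∈ (IntermediateField.adjoin K (Set.range ev)).toSubalgebra := hz
      rw [adjoin_toSubalgebra_of_isAlgebraic fun x _ ↦ Algebra.IsAlgebraic.isAlgebraic x] at h1
      have h2 : Algebra.adjoin K (Set.range ev) ≤ ev.range :=
        Algebra.adjoin_le fun _ hx ↦ hx
      exact h2 h1
    obtain ⟨o, rfl⟩ := hz'
    -- The value of o is that of some r integral over K[t]. The coordinates of r in the basis of
    -- constants are integral over k[t], so the value is a K-combination of values of ψ.
    obtain ⟨r, hr, hro⟩ := exists_isIntegral_adjoin_and_eq ht' hτ ev hα o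
    have hr' := isIntegral_of_isIntegral_adjoin (k := k) hr
    let u (i : ι) : A := ⟨b.repr (algebraMap O E' r) i, isIntegral_repr hb hr' i⟩
    have hru : r = ∑ i, algebraMap K O (e i) * g (u i) := by
      apply hinj
      rw [map_sum]
      conv_lhs => rw [← b.sum_repr (algebraMap O E' r)]
      refine Finset.sum_congr rfl fun i _ ↦ ?_
      rw [map_mul, hg, ← IsScalarTower.algebraMap_apply, ← hb, Algebra.smul_def, mul_comm]
      rfl
    have : (⟨ev o, hz⟩ : F) = ∑ i, e i • ψ (u i) := by
      apply Subtype.val_injective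
      change ev.toRingHom o = F.val (∑ i, e i • ψ (u i))
      rw [map_sum]
      change ev o = _
      rw [← hro, hru, map_sum]
      refine Finset.sum_congr rfl fun i _ ↦ ?_
      rw [map_mul, AlgHom.commutes, ← Algebra.smul_def]
      rfl
    change (⟨ev o, hz⟩ : F) ∈ _
    rw [this]
    exact sum_mem fun i _ ↦ Submodule.smul_mem _ _ (Submodule.subset_span ⟨u i, rfl⟩)

end ScalarExtension

end Specialization

/-! ### The constant field is algebraically closed in the function field. -/

section Constants

open Polynomial IntermediateField

variable {k K E E' : Type*} [Field k] [Field K] [Field E] [Field E'] [Algebra k K] [Algebra k E]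
  [Algebra K E'] [Algebra E E'] [Algebra k E'] [IsScalarTower k K E'] [IsScalarTower k E E']

/-- A root in `E` of the minimal polynomial of a generator of `K` over `k` is a constant, if the
powers of this generator are independent over `E`. -/
lemma mem_range_algebraMap_of_aeval_minpoly (pb : PowerBasis k K)
    {b : Module.Basis (Fin pb.dim) E E'} (hb : ∀ i, b i = algebraMap K E' (pb.basis i)) {t : E}
    (ht : aeval t (minpoly k pb.gen) = 0) : t ∈ Set.range (algebraMap k E) := by
  set γ := algebraMap K E' pb.gen with hγ
  -- The powers of γ below the degree of K over k are independent over E, so γ is a root of no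
  -- nonzero polynomial over E of smaller degree.
  have hzero (p : E[X]) (hp : p.natDegree < pb.dim) (hpγ : aeval γ p = 0) : p = 0 := by
    rw [aeval_eq_sum_range' hp, Finset.sum_range] at hpγ
    have h := Fintype.linearIndependent_iff.mp b.linearIndependent (fun i ↦ p.coeff i) (by
      rw [← hpγ]
      refine Finset.sum_congr rfl fun i _ ↦ ?_
      rw [hb, pb.basis_eq_pow, map_pow])
    ext j
    rcases lt_or_ge j pb.dim with hj | hj
    · exact h ⟨j, hj⟩
    · rw [coeff_eq_zero_of_natDegree_lt (by omega), coeff_zero]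
  set f := (minpoly k pb.gen).map (algebraMap k E) with hf
  have hfm : f.Monic := (minpoly.monic pb.isIntegral_gen).map _
  have hfd : f.natDegree = pb.dim := by
    rw [hf, natDegree_map, pb.natDegree_minpoly]
  have hroot : f.IsRoot t := by rwa [IsRoot, hf, eval_map_algebraMap]
  obtain ⟨h, hh⟩ := dvd_iff_isRoot.mpr hroot
  have hh0 : h ≠ 0 := by
    rintro rfl
    rw [mul_zero] at hh
    exact hfm.ne_zero hh
  have hhd : h.natDegree + 1 = pb.dim := by
    rw [← hfd, hh, natDegree_mul (X_sub_C_ne_zero t) hh0, natDegree_X_sub_C, add_comm]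
  have hfγ : aeval γ f = 0 := by
    rw [hf, aeval_map_algebraMap, hγ, aeval_algebraMap_apply, minpoly.aeval, map_zero]
  rw [hh, map_mul, mul_eq_zero] at hfγ
  -- Either factor of (X - t)h would be too small to vanish at γ, except X - t in degree 1, where
  -- the minimal polynomial is linear and t is constant.
  rcases hfγ with h1 | h1
  · rcases Nat.lt_or_ge 1 pb.dim with h2 | h2
    · exact absurd (hzero _ (by rw [natDegree_X_sub_C]; exact h2) h1) (X_sub_C_ne_zero t)
    · have hd : (minpoly k pb.gen).natDegree = 1 := by
        rw [pb.natDegree_minpoly]; omega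
      rw [(minpoly.monic pb.isIntegral_gen).eq_X_add_C hd, map_add, aeval_X, aeval_C] at ht
      exact ⟨-(minpoly k pb.gen).coeff 0, by rw [map_neg]; linear_combination -ht⟩
  · exact absurd (hzero h (by omega) h1) hh0

end Constants

namespace Curve

open IntermediateField Polynomial

variable {k : Type u} [Field k] (C : Curve k)

/-- The inclusion of `k(C)` into `K(C)` as an algebra structure. -/
noncomputable abbrev functionFieldAlgebra (K : Type u) [Field K] [Algebra k K] :
    Algebra C.FunctionField (C.baseChange K).FunctionField :=
  (C.functionFieldMap K).toAlgebra

/-- The inclusion of `k` into `K(C)` as an algebra structure. -/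
noncomputable abbrev constantAlgebra (K : Type u) [Field K] [Algebra k K] :
    Algebra k (C.baseChange K).FunctionField :=
  ((algebraMap K (C.baseChange K).FunctionField).comp (algebraMap k K)).toAlgebra

lemma isScalarTower_constantAlgebra (K : Type u) [Field K] [Algebra k K] :
    letI := C.constantAlgebra K
    IsScalarTower k K (C.baseChange K).FunctionField :=
  letI := C.constantAlgebra K
  .of_algebraMap_eq fun _ ↦ rfl

lemma isScalarTower_functionFieldAlgebra (K : Type u) [Field K] [Algebra k K] :
    letI := C.constantAlgebra K
    letI := C.functionFieldAlgebra K
    IsScalarTower k C.FunctionField (C.baseChange K).FunctionField :=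
  letI := C.constantAlgebra K
  letI := C.functionFieldAlgebra K
  .of_algebraMap_eq fun a ↦ (C.functionFieldMap_algebraMap K a).symm

lemma mem_range_of_aeval_minpoly {K : Type u} [Field K] [Algebra k K] (pb : PowerBasis k K)
    {t : C.FunctionField} (ht : aeval t (minpoly k pb.gen) = 0) :
    t ∈ Set.range (algebraMap k C.FunctionField) := by
  let _ := C.functionFieldAlgebra K
  let _ := C.constantAlgebra K
  have := C.isScalarTower_constantAlgebra K
  have := C.isScalarTower_functionFieldAlgebra K
  obtain ⟨b, hb⟩ := C.exists_basis_baseChange K pb.basis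
  exact mem_range_algebraMap_of_aeval_minpoly pb hb ht

variable {C} in
/-- The field `k` is algebraically closed in `k(C)`. -/
lemma IsNonconstant.transcendental {t : C.FunctionField} (ht : C.IsNonconstant t) :
    Transcendental k t := fun halg ↦
  -- The curve is extended to the finite extension k(t) itself, whose generator has t as a conjugate
  -- in k(C).
  ht (C.mem_range_of_aeval_minpoly (adjoin.powerBasis halg.isIntegral) (by
    rw [adjoin.powerBasis_gen, minpoly_gen, minpoly.aeval]))

end Curve

/-- No basis indexed by the empty type exists, so the discriminant ideal is zero. This settles d =
0, the default value of `Module.finrank` for infinite extensions, without proving k(C) finite over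
k(t). -/
lemma normalizedDiscriminant_eq_zero {K L : Type*} [Field K] [NumberField K] [Field L] [Algebra K L]
    (h : Module.finrank K L = 0) : normalizedDiscriminant K L = 0 := by
  have hbot : relativeDiscriminant K L = ⊥ := by
    rw [relativeDiscriminant, Ideal.span_eq_bot]
    rintro _ ⟨b, -⟩
    have := Module.Finite.of_basis b
    exact absurd h Module.finrank_pos.ne'
  have hn0 : Module.finrank ℚ K ≠ 0 := Module.finrank_pos.ne'
  rw [normalizedDiscriminant, hbot, Ideal.absNorm_bot, Nat.cast_zero,
    Real.zero_rpow (by positivity)]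

/-! ### Application to the curve and conclusion. -/

namespace Curve

open IntermediateField

variable {k : Type u} [Field k] (C : Curve k)

lemma span_poleBounded_eq_top [CharZero k] {t : C.FunctionField} (ht : C.IsNonconstant t)
    [FiniteDimensional k⟮t⟯ C.FunctionField] {K : Type u} [Field K] [Algebra k K] [Module.Finite k K]
    {x : (C.baseChange K).FunctionField} (hx : (C.baseChange K).IsNonconstant x)
    (hgen : IntermediateField.adjoin K {C.functionFieldMap K t, x} = ⊤) :
    Submodule.span k⟮t⟯ {w | PoleBounded k t ((C.baseChange K).functionDegree x) w} = ⊤ := by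
  let _ := C.functionFieldAlgebra K
  let _ := C.constantAlgebra K
  have := C.isScalarTower_constantAlgebra K
  have := C.isScalarTower_functionFieldAlgebra K
  obtain ⟨b, hb⟩ := C.exists_basis_baseChange K (Module.Free.chooseBasis k K)
  have : Module.Finite C.FunctionField (C.baseChange K).FunctionField := .of_basis b
  have := finiteDimensional_adjoin_algebraMap (k := k) K (C.baseChange K).FunctionField t
  refine span_poleBounded_eq_top_of_basis hb ?_
  exact _root_.span_poleBounded_eq_top (ht.transcendental.algebraMap_of_isAlgebraic (k := k))
    hx.transcendental hgen (Algebra.IsAlgebraic.isAlgebraic x) rfl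

/-- The abstract specialization is applied to the local ring at P, which is normal by smoothness. -/
lemma exists_specialization [CharZero k] {t : C.FunctionField} (ht : C.IsNonconstant t)
    [FiniteDimensional k⟮t⟯ C.FunctionField] {K : Type u} [Field K] [Algebra k K] [Module.Finite k K]
    (P : (C.baseChange K).Point (AlgebraicClosure K)) {α : K}
    (hα : HasValue (C.functionFieldMap K t) P (algebraMap K (AlgebraicClosure K) α)) :
    ∃ ψ : integralClosure (Algebra.adjoin k {t}) C.FunctionField →ₐ[k] P.field,
      ψ (integralClosureGen k t) = algebraMap K _ α ∧ Submodule.span K (Set.range ψ) = ⊤ := by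
  let _ := C.functionFieldAlgebra K
  let _ := C.constantAlgebra K
  have := C.isScalarTower_constantAlgebra K
  have := C.isScalarTower_functionFieldAlgebra K
  obtain ⟨b, hb⟩ := C.exists_basis_baseChange K (Module.Free.chooseBasis k K)
  let O := (C.baseChange K).X.presheaf.stalk P.pt
  let _ : Algebra O (C.baseChange K).FunctionField :=
    (inferInstance : Algebra O (C.baseChange K).X.functionField)
  have : IsFractionRing O (C.baseChange K).FunctionField :=
    (inferInstance : IsFractionRing O (C.baseChange K).X.functionField)
  let _ : Algebra K O := ((C.baseChange K).stalkConstants P.pt).toAlgebra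
  have : IsScalarTower K O (C.baseChange K).FunctionField :=
    .of_algebraMap_eq fun a ↦ ((C.baseChange K).algebraMap_stalkConstants P.pt a).symm
  have : IsIntegrallyClosed O := (C.baseChange K).isIntegrallyClosed_stalk P.pt
  let ev : O →ₐ[K] AlgebraicClosure K :=
    { P.eval with commutes' := P.eval_stalkConstants }
  obtain ⟨τ, hτ, hτα⟩ := hα
  exact _root_.exists_specialization hb ht.transcendental ev (τ := τ) hτ hτα

end Curve

theorem mainTheorem11 {k : Type u} [Field k] [NumberField k] (C : Curve k)
    (t : C.FunctionField) (ht : C.IsNonconstant t) (d : ℕ) (hd : C.functionDegree t = d) :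
    ∃ c : ℝ, 0 < c ∧
      ∀ (K : Type u) [Field K] [NumberField K] [Algebra k K] (m : ℕ),
        (∃ x : (C.baseChange K).FunctionField,
          (C.baseChange K).IsNonconstant x ∧ (C.baseChange K).functionDegree x = m ∧
            IntermediateField.adjoin K {C.functionFieldMap K t, x} = ⊤) →
        ∀ (P : (C.baseChange K).Point (AlgebraicClosure K)) (α : K),
          Curve.HasValue (C.functionFieldMap K t) P (algebraMap K (AlgebraicClosure K) α) →
          Module.finrank K P.field = d →
          normalizedDiscriminant K P.field
            ≤ c * absoluteHeight α ^ (2 * m * (d - 1)) := by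
  classical
  rcases Nat.eq_zero_or_pos d with rfl | hdpos
  · refine ⟨1, one_pos, fun K _ _ _ m _ P α _ hP ↦ ?_⟩
    rw [normalizedDiscriminant_eq_zero hP]
    have := one_le_absoluteHeight α
    positivity
  have hfin : FiniteDimensional (IntermediateField.adjoin k {t}) C.FunctionField :=
    Module.finite_of_finrank_pos (hd.symm ▸ hdpos : 0 < C.functionDegree t)
  let IsSpan (m : ℕ) : Prop :=
    Submodule.span (IntermediateField.adjoin k {t}) {w | PoleBounded k t m w} = ⊤
  have hspan (K : Type u) [Field K] [NumberField K] [Algebra k K] (m : ℕ)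
      (h : ∃ x : (C.baseChange K).FunctionField,
        (C.baseChange K).IsNonconstant x ∧ (C.baseChange K).functionDegree x = m ∧
          IntermediateField.adjoin K {C.functionFieldMap K t, x} = ⊤) : IsSpan m := by
    obtain ⟨x, hx, rfl, hgen⟩ := h
    have : Module.Finite k K := .of_restrictScalars_finite ℚ k K
    exact C.span_poleBounded_eq_top ht hx hgen
  -- `IsSpan` does not mention K. Its least solution therefore yields a constant depending only on C
  -- and t, and every admissible pair (K, m) has m at least as large; if there is no solution, there
  -- is no admissible pair.
  by_cases hm : ∃ m, IsSpan m
  · obtain ⟨c, hc, H⟩ :=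
      exists_normalizedDiscriminant_le_of_span ht.transcendental hd (Nat.find_spec hm)
    refine ⟨c, hc, fun K _ _ _ m hx P α hα hP ↦ ?_⟩
    have : Module.Finite k K := .of_restrictScalars_finite ℚ k K
    obtain ⟨ψ, hψ, hψspan⟩ := C.exists_specialization ht P hα
    refine (H K P.field α ψ hψ hψspan hP).trans (mul_le_mul_of_nonneg_left
      (pow_le_pow_right₀ (one_le_absoluteHeight α) ?_) hc.le)
    rw [mul_assoc]
    exact Nat.mul_le_mul_left 2 (Nat.mul_le_mul_right _ (Nat.find_min' hm (hspan K m hx)))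
  · exact ⟨1, one_pos, fun K _ _ _ m hx ↦ absurd ⟨m, hspan K m hx⟩ hm⟩
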